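/- Let $n\ge 1$, let $X=[0,1]^n$ with the Euclidean metric $d$, let $0<\alpha<1$, and let $X^\alpha=(X,d^\alpha)$. Let $\mathrm{Lip}(X^\alpha)$ be the space of functions $f:X\to\mathbb R$ that are Lipschitz for $d^\alpha$, with the norm $\|f\|=\max\{\|f\|_\infty,L(f)\}$, where $L(f)$ is the best Lipschitz constant of $f$ with respect to $d^\alpha$. Let $\mathrm{lip}(X^\alpha)$ be the subspace of those $f$ with $\sup_{0<d(x,x')<\delta}|f(x)-f(x')|/d(x,x')^\alpha\to0$ as $\delta\to0$. The predual Æ$(X^\alpha)$ of $\mathrm{Lip}(X^\alpha)$ is the completion of the space of signed Radon measures on $X$ with respect to $\|\mu\|_{KR}=\sup\{\int u\,d\mu:\ L(u)\le1,\ \|u\|_\infty\le1\}$, and the weak-* topology of $\mathrm{Lip}(X^\alpha)$ is the one given by the pairing with Æ$(X^\alpha)$ that extends $\langle\mu,f\rangle=\int f\,d\mu$. Let $D_0=\{0,1\}$, $D_k=\{(2p-1)2^{-k}:1\le p\le 2^{k-1}\}$ for $k\ge1$, $D=\bigcup_{k\ge0}D_k$, and let $D^n_k$ be the set of those $\tau=(\tau_1,\dots,\tau_n)$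 with every $\tau_i\in\bigcup_{j\le k}D_j$ and some $\tau_{i}\in D_k$; then $D^n$ is the disjoint union of the sets $D^n_k$, $k\ge 0$. Let $\psi(t)=1-|t|$ for $|t|\le1$ and $\psi(t)=0$ otherwise. For $\tau\in D^n_k$ let $$\tilde f_\tau(x)=2^{-\alpha k}\prod_{i=1}^n\psi\bigl(2^k(x_i-\tau_i)\bigr),\qquad x\in[0,1]^n,$$ and let $\tilde\mu_\tau=\delta_\tau$ if $k=0$ and $\tilde\mu_\tau=2^{\alpha k-n}\sum_{\varepsilon\in\{-1,1\}^n}(\delta_\tau-\delta_{\tau^\varepsilon})$ if $k\ge1$, where $\tau^\varepsilon_i=\tau_i+\varepsilon_i2^{-k}$ if $\tau_i\in D_k$ and $\tau^\varepsilon_i=\tau_i$ otherwise. Then for every $f\in\mathrm{Lip}(X^\alpha)$ $$f=\sum_{\tau\in D^n}\langle\tilde\mu_\tau,f\rangle\,\tilde f_\tau\qquad\text{weakly-* in }\mathrm{Lip}(X^\alpha).$$ Weak-* convergence of this series is equivalent to uniform convergence: its finite partial sums form a bounded subset of $\mathrm{Lip}(X^\alpha)$, and on every bounded subset of $\mathrm{Lip}(X^\alpha)$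 the weak-* topology coincides with the topology of uniform convergence. In particular, the series converges to $f$ uniformly. If, in addition, $f\in\mathrm{lip}(X^\alpha)$, the series converges to $f$ in the norm of $\mathrm{Lip}(X^\alpha)$. In each case the convergence is that of the net of the partial sums over finite subsets of $D^n$, that is, it is unconditional. -/

import Mathlib

open MeasureTheory Filter Topology Set
open scoped NNReal

noncomputable section

namespace FaberSchauder

section LipschitzSpaces

variable (X : Type*) [MetricSpace X] [CompactSpace X] (α : ℝ≥0)

/-- The continuous functions on `X` that are Hölder continuous with exponent `α`, i.e. Lipschitz
with respect to the metric `d ^ α`, as a subspace of `C(X, ℝ)`. -/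
def lipSubmodule : Submodule ℝ C(X, ℝ) where
  carrier := {f | MemHolder α f}
  add_mem' hf hg := MemHolder.add hf hg
  zero_mem' := memHolder_zero
  smul_mem' _ _ hf := MemHolder.smul hf

/-- The space `Lip(X^α)`, where `X^α` is `X` with the metric `d ^ α`. -/
def Lip : Type _ := lipSubmodule X α

instance : AddCommGroup (Lip X α) := inferInstanceAs (AddCommGroup (lipSubmodule X α))
instance : Module ℝ (Lip X α) := inferInstanceAs (Module ℝ (lipSubmodule X α))

variable {X α}

/-- The inclusion of `Lip(X^α)` in `C(X)`. -/
def toC : Lip X α →ₗ[ℝ] C(X, ℝ) := (lipSubmodule X α).subtype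

instance : FunLike (Lip X α) X ℝ where
  coe f := toC f
  coe_injective f g h := Subtype.ext (DFunLike.coe_injective h)

/-- The best Lipschitz constant `L(f)` of `f` with respect to `d ^ α`. -/
def lipConst (f : Lip X α) : ℝ≥0 := nnHolderNorm α f

theorem Lip.memHolder (f : Lip X α) : MemHolder α f := f.2

variable (X α)

/-- The norm `max {‖f‖_∞, L(f)}`. -/
def lipNorm : AddGroupNorm (Lip X α) where
  toFun f := max ‖toC f‖ (lipConst f)
  map_zero' := by
    have h : lipConst (0 : Lip X α) = 0 := nnHolderNorm_zero X α
    simp [h]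
  add_le' f g := by
    have h : (lipConst (f + g) : ℝ) ≤ lipConst f + lipConst g := by
      exact_mod_cast MemHolder.nnHolderNorm_add_le f.memHolder g.memHolder
    rw [map_add]
    refine max_le ((norm_add_le _ _).trans ?_) (h.trans ?_)
    · exact add_le_add (le_max_left _ _) (le_max_left _ _)
    · exact add_le_add (le_max_right _ _) (le_max_right _ _)
  neg' f := by
    have h : lipConst (-f) = lipConst f := by
      have := MemHolder.nnHolderNorm_smul f.memHolder (-1 : ℝ)
      simp only [nnnorm_neg, nnnorm_one, one_mul, neg_smul, one_smul] at this
      exact this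
    rw [h, map_neg, norm_neg]
  eq_zero_of_map_eq_zero' f hf := by
    have h : ‖toC f‖ ≤ 0 := hf ▸ le_max_left _ _
    exact Subtype.ext (norm_le_zero_iff.1 h)

instance : NormedAddCommGroup (Lip X α) := AddGroupNorm.toNormedAddCommGroup (lipNorm X α)

variable {X α}

theorem lip_norm_def (f : Lip X α) : ‖f‖ = max ‖toC f‖ (lipConst f) := rfl

instance : NormedSpace ℝ (Lip X α) where
  norm_smul_le c f := by
    have h : (lipConst (c • f) : ℝ) = ‖c‖ * lipConst f := by
      have := MemHolder.nnHolderNorm_smul f.memHolder c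
      exact congrArg ((↑) : ℝ≥0 → ℝ) this
    rw [lip_norm_def, lip_norm_def, map_smul, norm_smul, h,
      mul_max_of_nonneg _ _ (norm_nonneg c)]

variable (X α)

/-- The little Lipschitz space `lip(X^α)` of locally flat functions: the supremum of
`|f(x) - f(x')| / d(x,x')^α` over `0 < d(x,x') < δ` tends to `0` as `δ → 0`. -/
def littleLip : Set (Lip X α) :=
  {f | ∀ ε > 0, ∃ δ > 0, ∀ x x' : X, 0 < dist x x' → dist x x' < δ →
    |f x - f x'| / dist x x' ^ (α : ℝ) ≤ ε}

variable {X} [MeasurableSpace X] [BorelSpace X]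

/-- The functional `f ↦ ∫ f dμ` on `Lip(X^α)`. -/
def integralFunctional (μ : FiniteMeasure X) : StrongDual ℝ (Lip X α) :=
  LinearMap.mkContinuous
    { toFun f := ∫ x, f x ∂(μ : Measure X)
      map_add' f g := by
        exact integral_add
          ((toC f).continuous.integrable_of_hasCompactSupport (.of_compactSpace _))
          ((toC g).continuous.integrable_of_hasCompactSupport (.of_compactSpace _))
      map_smul' c f := integral_const_mul c (fun x => f x) }
    ((μ : Measure X).real univ) (fun f => by
      have h : ∀ x, ‖f x‖ ≤ ‖f‖ := fun x =>
        ((toC f).norm_coe_le_norm x).trans (le_max_left _ _)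
      have := norm_integral_le_of_norm_le_const (μ := (μ : Measure X)) (.of_forall h)
      exact this.trans_eq (mul_comm _ _))

variable (X)

/-- The predual `Æ(X^α)` of `Lip(X^α)`: the completion of the space of (signed) Radon measures
on `X` with respect to the Kantorovich–Rubinstein norm
`sup {∫ u dμ : L(u) ≤ 1, ‖u‖_∞ ≤ 1}`. This norm is the norm of `μ` as a functional on `Lip(X^α)`,
so the completion is the closure of the space of Radon measures in the dual of `Lip(X^α)`; signed
measures are linear combinations of finite positive ones. -/
def ArensEells : Submodule ℝ (StrongDual ℝ (Lip X α)) :=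
  (Submodule.span ℝ (range (integralFunctional (X := X) α))).topologicalClosure

variable {X}

/-- The Dirac measure at `x`, as an element of `Æ(X^α)`. -/
def dirac (x : X) : ArensEells X α :=
  ⟨integralFunctional α ⟨Measure.dirac x, inferInstance⟩,
    Submodule.le_topologicalClosure _ (Submodule.subset_span ⟨_, rfl⟩)⟩

variable {α}

/-- The duality pairing `⟨η, f⟩` of `η ∈ Æ(X^α)` and `f ∈ Lip(X^α)`. -/
def pairing (η : ArensEells X α) (f : Lip X α) : ℝ := (η : StrongDual ℝ (Lip X α)) f

theorem pairing_dirac (x : X) (f : Lip X α) : pairing (dirac α x) f = f x :=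
  integral_dirac (fun y => f y) x

/-- The canonical map of `Lip(X^α)` into the dual of `Æ(X^α)`. -/
def toDualPredual (f : Lip X α) : WeakDual ℝ (ArensEells X α) :=
  StrongDual.toWeakDual
    ((NormedSpace.inclusionInDoubleDual ℝ (Lip X α) f).comp (ArensEells X α).subtypeL)

theorem toDualPredual_apply (f : Lip X α) (η : ArensEells X α) :
    toDualPredual f η = pairing η f := rfl

variable (X α)

/-- The weak-* topology of `Lip(X^α)` as the dual of `Æ(X^α)`. -/
abbrev weakStar : TopologicalSpace (Lip X α) :=
  TopologicalSpace.induced toDualPredual inferInstance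

/-- The topology of uniform convergence on `Lip(X^α)`. -/
abbrev uniformTopology : TopologicalSpace (Lip X α) :=
  TopologicalSpace.induced toC inferInstance

end LipschitzSpaces

section Cube

/-- The unit cube `[0,1]^n` with the Euclidean metric. -/
abbrev Cube (n : ℕ) : Type := {x : EuclideanSpace ℝ (Fin n) // ∀ i, x i ∈ Icc (0 : ℝ) 1}

instance (n : ℕ) : CompactSpace (Cube n) := by
  have h : IsCompact ((EuclideanSpace.equiv (Fin n) ℝ).symm ''
      Set.pi univ (fun _ => Icc (0 : ℝ) 1)) :=
    (isCompact_univ_pi fun _ => isCompact_Icc).image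
      (EuclideanSpace.equiv (Fin n) ℝ).symm.continuous
  have e : {x : EuclideanSpace ℝ (Fin n) | ∀ i, x i ∈ Icc (0 : ℝ) 1} =
      (EuclideanSpace.equiv (Fin n) ℝ).symm '' Set.pi univ (fun _ => Icc (0 : ℝ) 1) := by
    ext x
    constructor
    · intro hx
      exact ⟨EuclideanSpace.equiv (Fin n) ℝ x, fun i _ => hx i, by simp⟩
    · rintro ⟨y, hy, rfl⟩ i
      exact hy i trivial
  rw [← e] at h
  exact isCompact_iff_compactSpace.1 h

/-- The hat function `ψ`. -/
def hat (t : ℝ) : ℝ := if t ∈ Icc (-1 : ℝ) 1 then 1 - |t| else 0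

/-- `D_0 = {0, 1}` and `D_k = {(2p - 1) 2^{-k} : p = 1, …, 2^{k-1}}` for `k ≥ 1`. -/
def dyadic : ℕ → Set ℝ
  | 0 => {0, 1}
  | k + 1 => {t | ∃ p : ℕ, 1 ≤ p ∧ p ≤ 2 ^ k ∧ t = (2 * p - 1) * (2 ^ (k + 1))⁻¹}

/-- `D^n_k`, the set of the points of `D^n` whose highest resolution is `k`. -/
def dyadicMulti (n k : ℕ) : Set (Fin n → ℝ) :=
  {τ | (∀ i, ∃ j ≤ k, τ i ∈ dyadic j) ∧ ∃ i, τ i ∈ dyadic k}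

/-- The index set `D^n`. For `n ≥ 1` it is the disjoint union of the sets `D^n_k`; an index is
stored together with its resolution `k`. -/
abbrev Index (n : ℕ) : Type := Σ k : ℕ, dyadicMulti n k

theorem dyadic_disjoint {j k : ℕ} (hjk : j < k) {t : ℝ} (hj : t ∈ dyadic j) : t ∉ dyadic k := by
  obtain ⟨k, rfl⟩ : ∃ m, k = m + 1 := ⟨k - 1, by omega⟩
  rintro ⟨p, -, -, hp⟩
  have hone : (2 ^ (k + 1) : ℝ) * (2 ^ (k + 1))⁻¹ = 1 := mul_inv_cancel₀ (by positivity)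
  have h1 : t * 2 ^ (k + 1) = 2 * p - 1 := by rw [hp, mul_assoc, mul_comm _ (2 ^ (k + 1)), hone]; ring
  obtain ⟨z, hz⟩ : ∃ z : ℤ, t * 2 ^ k = z := by
    cases j with
    | zero =>
      rcases hj with rfl | rfl
      · exact ⟨0, by simp⟩
      · exact ⟨2 ^ k, by simp⟩
    | succ j =>
      obtain ⟨q, -, -, rfl⟩ := hj
      obtain ⟨d, rfl⟩ : ∃ d, k = (j + 1) + d := ⟨k - (j + 1), by omega⟩
      have hone' : (2 ^ (j + 1) : ℝ)⁻¹ * 2 ^ (j + 1) = 1 := inv_mul_cancel₀ (by positivity)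
      refine ⟨(2 * q - 1) * 2 ^ d, ?_⟩
      rw [pow_add (2 : ℝ) (j + 1) d, mul_assoc, ← mul_assoc _ (2 ^ (j + 1)) (2 ^ d), hone']
      push_cast
      ring
  have h2 : (2 * z : ℝ) = 2 * p - 1 := by rw [← hz, ← h1]; ring
  have h3 : 2 * z = 2 * (p : ℤ) - 1 := by exact_mod_cast h2
  omega

/-- Forgetting the resolution identifies the index set with `D^n`, where `D` is the union of the
sets `D_k`. -/
theorem index_bijOn {n : ℕ} (hn : 1 ≤ n) :
    Function.Injective (fun τ : Index n => τ.2.1) ∧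
      range (fun τ : Index n => τ.2.1) = {τ | ∀ i, τ i ∈ ⋃ k, dyadic k} := by
  constructor
  · rintro ⟨k, σ, hσ⟩ ⟨l, τ, hτ⟩ (rfl : σ = τ)
    have key : ∀ {a b : ℕ}, σ ∈ dyadicMulti n a → σ ∈ dyadicMulti n b → a ≤ b := by
      intro a b ha hb
      obtain ⟨i, hi⟩ := ha.2
      obtain ⟨j, hj, hij⟩ := hb.1 i
      by_contra! h
      exact dyadic_disjoint (lt_of_le_of_lt hj h) hij hi
    obtain rfl : k = l := le_antisymm (key hσ hτ) (key hτ hσ)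
    rfl
  · ext τ
    constructor
    · rintro ⟨⟨k, σ, hσ⟩, rfl⟩ i
      obtain ⟨j, -, hj⟩ := hσ.1 i
      exact mem_iUnion.2 ⟨j, hj⟩
    · intro h
      choose r hr using fun i => mem_iUnion.1 (h i)
      have : Nonempty (Fin n) := ⟨⟨0, hn⟩⟩
      obtain ⟨i, -, hi⟩ := Finset.exists_max_image Finset.univ r Finset.univ_nonempty
      exact ⟨⟨r i, τ, fun l => ⟨r l, hi l (Finset.mem_univ l), hr l⟩, i, hr i⟩, rfl⟩

theorem hat_eq (t : ℝ) : hat t = max 0 (1 - |t|) := by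
  unfold hat
  split_ifs with h
  · rw [max_eq_right]
    linarith [abs_le.2 h]
  · rw [max_eq_left]
    have : ¬ |t| ≤ 1 := fun h' => h (abs_le.1 h')
    linarith

theorem dyadic_bounds {k : ℕ} {t : ℝ} (h : t ∈ dyadic (k + 1)) :
    (2 ^ (k + 1) : ℝ)⁻¹ ≤ t ∧ t ≤ 1 - (2 ^ (k + 1))⁻¹ := by
  obtain ⟨p, h1, h2, rfl⟩ := h
  have h1' : (1 : ℝ) ≤ p := by exact_mod_cast h1
  have h2' : (p : ℝ) ≤ 2 ^ k := by exact_mod_cast h2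
  have hpos : (0 : ℝ) < (2 ^ (k + 1))⁻¹ := by positivity
  have hone : (2 ^ (k + 1) : ℝ) * (2 ^ (k + 1))⁻¹ = 1 := mul_inv_cancel₀ (by positivity)
  have hk : (2 : ℝ) ^ (k + 1) = 2 * 2 ^ k := by ring
  constructor
  · nlinarith
  · have : (2 * (p : ℝ) - 1) ≤ 2 ^ (k + 1) - 1 := by rw [hk]; linarith
    nlinarith

theorem dyadic_mem_Icc {k : ℕ} {t : ℝ} (h : t ∈ dyadic k) : t ∈ Icc (0 : ℝ) 1 := by
  cases k with
  | zero => rcases h with rfl | rfl <;> simp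
  | succ k =>
    have hpos : (0 : ℝ) < (2 ^ (k + 1))⁻¹ := by positivity
    have := dyadic_bounds h
    exact ⟨by linarith, by linarith⟩

/-- `τ ∈ D^n` as a point of the cube. -/
def node {n k : ℕ} (τ : dyadicMulti n k) : Cube n :=
  ⟨WithLp.toLp 2 τ.1, fun i => by
    obtain ⟨j, -, hj⟩ := τ.2.1 i
    exact dyadic_mem_Icc hj⟩

open Classical in
/-- For `τ ∈ D^n_k` with `k ≥ 1` and `ε ∈ {-1, 1}^n`, the point `τ^ε` of the cube, whose `i`-th
coordinate is `τ_i + ε_i 2^{-k}` if `τ_i ∈ D_k` and `τ_i` otherwise. -/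
def neighbour {n k : ℕ} (τ : dyadicMulti n (k + 1)) (ε : Fin n → ℤˣ) : Cube n :=
  ⟨WithLp.toLp 2 fun i =>
      if τ.1 i ∈ dyadic (k + 1) then τ.1 i + ((ε i : ℤ) : ℝ) * (2 ^ (k + 1))⁻¹ else τ.1 i,
    fun i => by
      change (if τ.1 i ∈ dyadic (k + 1) then τ.1 i + ((ε i : ℤ) : ℝ) * (2 ^ (k + 1))⁻¹
        else τ.1 i) ∈ Icc (0 : ℝ) 1
      have hpos : (0 : ℝ) < (2 ^ (k + 1))⁻¹ := by positivity
      split_ifs with h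
      · have := dyadic_bounds h
        rcases Int.units_eq_one_or (ε i) with he | he <;> rw [he] <;>
          constructor <;> push_cast <;> linarith
      · obtain ⟨j, -, hj⟩ := τ.2.1 i
        exact dyadic_mem_Icc hj⟩

/-- The Faber–Schauder function `f_τ(x) = ∏ᵢ ψ(2^k (xᵢ - τᵢ))`, for `τ ∈ D^n_k`. -/
def schauderC {n : ℕ} (τ : Index n) : C(Cube n, ℝ) where
  toFun x := ∏ i, hat (2 ^ τ.1 * (x.1 i - τ.2.1 i))
  continuous_toFun := by
    simp only [hat_eq]
    fun_prop

theorem abs_prod_sub_prod_le {ι : Type*} (s : Finset ι) (a b : ι → ℝ)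
    (ha : ∀ i, a i ∈ Icc (0 : ℝ) 1) (hb : ∀ i, b i ∈ Icc (0 : ℝ) 1) :
    |∏ i ∈ s, a i - ∏ i ∈ s, b i| ≤ ∑ i ∈ s, |a i - b i| := by
  classical
  induction s using Finset.induction_on with
  | empty => simp
  | insert j s hj ih =>
    rw [Finset.prod_insert hj, Finset.prod_insert hj, Finset.sum_insert hj]
    have h1 : a j * ∏ i ∈ s, a i - b j * ∏ i ∈ s, b i =
        (a j - b j) * ∏ i ∈ s, a i + b j * (∏ i ∈ s, a i - ∏ i ∈ s, b i) := by ring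
    rw [h1]
    refine (abs_add_le _ _).trans (add_le_add ?_ ?_)
    · rw [abs_mul]
      refine mul_le_of_le_one_right (abs_nonneg _) ?_
      rw [abs_of_nonneg (Finset.prod_nonneg fun i _ => (ha i).1)]
      exact Finset.prod_le_one (fun i _ => (ha i).1) (fun i _ => (ha i).2)
    · rw [abs_mul, abs_of_nonneg (hb j).1]
      exact (mul_le_of_le_one_left (abs_nonneg _) (hb j).2).trans ih

theorem hat_mem (t : ℝ) : hat t ∈ Icc (0 : ℝ) 1 := by
  rw [hat_eq]
  exact ⟨le_max_left _ _, max_le zero_le_one (by linarith [abs_nonneg t])⟩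

theorem hat_lipschitz (s t : ℝ) : |hat s - hat t| ≤ |s - t| := by
  rw [hat_eq, hat_eq, max_comm 0, max_comm 0]
  refine (abs_max_sub_max_le_abs _ _ _).trans ?_
  rw [show 1 - |s| - (1 - |t|) = |t| - |s| by ring, abs_sub_comm s t]
  exact abs_abs_sub_abs_le _ _

theorem schauderC_memHolder {n : ℕ} {α : ℝ≥0} (hα : α ≤ 1) (τ : Index n) :
    MemHolder α (schauderC τ) := by
  have hL : LipschitzWith (n * 2 ^ τ.1) (schauderC τ) := by
    refine LipschitzWith.of_dist_le_mul fun x y => ?_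
    rw [Real.dist_eq]
    refine (abs_prod_sub_prod_le Finset.univ _ _ (fun i => hat_mem (2 ^ τ.1 * (x.1 i - τ.2.1 i)))
      (fun i => hat_mem (2 ^ τ.1 * (y.1 i - τ.2.1 i)))).trans ?_
    have : ∀ i ∈ Finset.univ, |hat (2 ^ τ.1 * (x.1 i - τ.2.1 i)) -
        hat (2 ^ τ.1 * (y.1 i - τ.2.1 i))| ≤ 2 ^ τ.1 * dist x y := by
      intro i _
      refine (hat_lipschitz _ _).trans ?_
      rw [← mul_sub, abs_mul, abs_of_pos (by positivity : (0 : ℝ) < 2 ^ τ.1),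
        sub_sub_sub_cancel_right]
      refine mul_le_mul_of_nonneg_left ?_ (by positivity)
      have := PiLp.norm_apply_le (x.1 - y.1) i
      rw [← dist_eq_norm] at this
      exact this
    refine (Finset.sum_le_card_nsmul _ _ _ this).trans ?_
    simp [mul_assoc]
  exact MemHolder.of_le hL.holderWith.memHolder hα

variable {n : ℕ} {α : ℝ≥0}

/-- The Faber–Schauder function `f_τ` as an element of `Lip(X^α)`, for `α ≤ 1`. -/
def schauder (hα : α ≤ 1) (τ : Index n) : Lip (Cube n) α :=
  ⟨schauderC τ, schauderC_memHolder hα τ⟩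

/-- The renormalised Faber–Schauder function `2^{-αk} f_τ`, for `τ ∈ D^n_k`. -/
def schauderNormalised (hα : α ≤ 1) (τ : Index n) : Lip (Cube n) α :=
  (2 : ℝ) ^ (-(α : ℝ) * τ.1) • schauder hα τ

theorem schauderNormalised_apply (hα : α ≤ 1) (τ : Index n) (x : Cube n) :
    schauderNormalised hα τ x =
      (2 : ℝ) ^ (-(α : ℝ) * τ.1) * ∏ i, hat (2 ^ τ.1 * (x.1 i - τ.2.1 i)) := rfl

variable (α) in
/-- The renormalised coefficient functional: the measure `δ_τ` for `τ ∈ D^n_0` and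
`2^{αk - n} ∑_ε (δ_τ - δ_{τ^ε})` for `τ ∈ D^n_k`, `k ≥ 1`. -/
def coeffNormalised : Index n → ArensEells (Cube n) α
  | ⟨0, τ⟩ => dirac α (node τ)
  | ⟨k + 1, τ⟩ => (2 : ℝ) ^ ((α : ℝ) * ((k + 1 : ℕ) : ℝ) - n) •
      ∑ ε : Fin n → ℤˣ, (dirac α (node τ) - dirac α (neighbour τ ε))

theorem pairing_coeffNormalised_zero (τ : dyadicMulti n 0) (f : Lip (Cube n) α) :
    pairing (coeffNormalised α ⟨0, τ⟩) f = f (node τ) :=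
  pairing_dirac _ _

theorem pairing_coeffNormalised_succ {k : ℕ} (τ : dyadicMulti n (k + 1)) (f : Lip (Cube n) α) :
    pairing (coeffNormalised α ⟨k + 1, τ⟩) f =
      (2 : ℝ) ^ ((α : ℝ) * ((k + 1 : ℕ) : ℝ) - n) *
        ∑ ε : Fin n → ℤˣ, (f (node τ) - f (neighbour τ ε)) := by
  simp only [← pairing_dirac (α := α)]
  simp [pairing, coeffNormalised]

/-- The partial sum of the series `∑_τ ⟨μ̃_τ, f⟩ f̃_τ` over a finite set of indices. -/
def partialSum (hα : α ≤ 1) (f : Lip (Cube n) α) (F : Finset (Index n)) : Lip (Cube n) α :=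
  ∑ τ ∈ F, pairing (coeffNormalised α τ) f • schauderNormalised hα τ

end Cube

end FaberSchauder

end

open FaberSchauder

/-!
The partial sum `P_K` over all indices of level at most `K` is the multilinear interpolation of `f`
on the dyadic grid of mesh `2^{-K}` (`partialSum_levels_eq_on_dyadicGrid`). By induction on `K`: the
functions of level at most `K` are affine in each coordinate between neighbouring grid points, so
their value at a node of level `K + 1` is the mean over its neighbours (`schauderC_node_eq_mean`),
and the coefficient of the node is exactly the correction needed there.

The analytic core is an upper `c₀`-estimate
(`exists_norm_sum_smul_schauderNormalised_le`): a finite combination of the renormalised functions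
with coefficients bounded by `M` has Lipschitz norm at most `C M`. At most `2^n` functions of a level
are nonzero at a point, so the increment of the level `k` part between points at distance `d` is of
order `M 2^{-αk} min (1, 2^k d)`, and since `0 < α < 1` the sum over `k` is of order `M d^α`
(`sum_rpow_mul_min_le`).

As the coefficients of `f` are bounded by a multiple of its norm, all the partial sums lie in one
ball. The terms of level at least `K` sum uniformly to `O(2^{-αK})`, and `P_K`, being equal to `f` on
the grid and uniformly Hölder, is uniformly close to `f`; this gives uniform convergence of the net.
On bounded sets uniform and weak-* convergence agree: integral functionals are continuous for the
supremum norm and dense in the predual, while bounded sets are equicontinuous, so that convergence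
tested on Dirac measures is uniform by Ascoli's theorem. Finally, for locally flat `f` the
coefficients tend to zero with the level, so the `c₀`-estimate makes the net of partial sums Cauchy
in norm, and closed balls of the Lipschitz space are closed under pointwise convergence.
-/

noncomputable section

namespace FaberSchauder

/-! ### Norm and weak-* topology of a Lipschitz space -/

section General

variable {X : Type*} [MetricSpace X] [CompactSpace X] {α : ℝ≥0}

theorem Lip.abs_apply_le_norm (f : Lip X α) (x : X) : |f x| ≤ ‖f‖ :=
  ((toC f).norm_coe_le_norm x).trans (le_max_left _ _)

theorem Lip.abs_sub_le_norm_mul (f : Lip X α) (x y : X) :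
    |f x - f y| ≤ ‖f‖ * dist x y ^ (α : ℝ) := by
  have h := f.memHolder.holderWith.dist_le x y
  rw [Real.dist_eq] at h
  exact h.trans (mul_le_mul_of_nonneg_right (le_max_right _ _) (by positivity))

theorem Lip.norm_le_of_bounds {f : Lip X α} {C : ℝ} (hC : 0 ≤ C) (h₀ : ∀ x, |f x| ≤ C)
    (h₁ : ∀ x y, |f x - f y| ≤ C * dist x y ^ (α : ℝ)) : ‖f‖ ≤ C := by
  refine max_le ((ContinuousMap.norm_le _ hC).2 h₀) ?_
  lift C to ℝ≥0 using hC
  refine NNReal.coe_le_coe.2 (HolderWith.nnholderNorm_le (f := f) fun x y => ?_)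
  have h : nndist (f x) (f y) ≤ C * nndist x y ^ (α : ℝ) := by
    have := h₁ x y
    rw [← Real.dist_eq] at this
    exact_mod_cast this
  rw [edist_nndist, edist_nndist, ← ENNReal.coe_rpow_of_nonneg _ α.coe_nonneg]
  exact_mod_cast h

/-- Closed balls of `Lip(X^α)` are closed under pointwise convergence. -/
theorem Lip.norm_sub_le_of_tendsto {ι : Type*} {l : Filter ι} [l.NeBot] {g : ι → Lip X α}
    {f h : Lip X α} {C : ℝ} (hg : ∀ x, Tendsto (fun i => g i x) l (𝓝 (f x)))
    (hC : ∀ᶠ i in l, ‖g i - h‖ ≤ C) : ‖f - h‖ ≤ C := by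
  obtain ⟨i, hi⟩ := hC.exists
  refine Lip.norm_le_of_bounds ((norm_nonneg _).trans hi) (fun x => ?_) fun x y => ?_
  · exact le_of_tendsto ((hg x).sub_const (h x)).abs
      (hC.mono fun i hi => ((g i - h).abs_apply_le_norm x).trans hi)
  · exact le_of_tendsto (((hg x).sub_const (h x)).sub ((hg y).sub_const (h y))).abs
      (hC.mono fun i hi => ((g i - h).abs_sub_le_norm_mul x y).trans
        (mul_le_mul_of_nonneg_right hi (by positivity)))

/-- A bounded subset of `Lip(X^α)` is equicontinuous, so that on it pointwise convergence is
uniform. -/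
theorem tendsto_toC_of_tendsto_apply (hα : 0 < α) {ι : Type*} {l : Filter ι} {g : ι → Lip X α}
    {f : Lip X α} {C : ℝ} (hb : ∀ i, ‖g i‖ ≤ C)
    (h : ∀ x, Tendsto (fun i => g i x) l (𝓝 (f x))) :
    Tendsto (fun i => toC (g i)) l (𝓝 (toC f)) := by
  have he : Equicontinuous fun i (x : X) => g i x := by
    refine Metric.equicontinuous_of_continuity_modulus (fun t => C * t ^ (α : ℝ)) ?_ _ ?_
    · have : Tendsto (fun t : ℝ => C * t ^ (α : ℝ)) (𝓝 0) (𝓝 (C * 0 ^ (α : ℝ))) :=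
        ((Real.continuousAt_rpow_const 0 _ (Or.inr α.coe_nonneg)).tendsto).const_mul C
      rwa [Real.zero_rpow (by exact_mod_cast hα.ne'), mul_zero] at this
    · intro x y i
      rw [Real.dist_eq]
      exact ((g i).abs_sub_le_norm_mul x y).trans
        (mul_le_mul_of_nonneg_right (hb i) (by positivity))
  rw [ContinuousMap.tendsto_iff_tendstoUniformly]
  exact UniformFun.tendsto_iff_tendstoUniformly.1
    ((he.tendsto_uniformFun_iff_pi l f).2 (tendsto_pi_nhds.2 h))

variable [MeasurableSpace X] [BorelSpace X]

/-- Uniform convergence of a bounded family implies weak-* convergence: the integral functionals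
are continuous for the supremum norm, and on a bounded set the elements of their closure are
uniform limits of them. -/
theorem tendsto_toDualPredual {ι : Type*} {l : Filter ι} {g : ι → Lip X α} {f : Lip X α} {C : ℝ}
    (hb : ∀ i, ‖g i‖ ≤ C) (h : Tendsto (fun i => toC (g i)) l (𝓝 (toC f))) :
    Tendsto (fun i => toDualPredual (g i)) l (𝓝 (toDualPredual f)) := by
  rw [tendsto_iff_forall_eval_tendsto_topDualPairing]
  rintro ⟨η, hη⟩
  change Tendsto (fun i => η (g i)) l (𝓝 (η f))
  have hspan : ∀ θ ∈ Submodule.span ℝ (range (integralFunctional (X := X) α)),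
      Tendsto (fun i => θ (g i)) l (𝓝 (θ f)) := by
    intro θ hθ
    induction hθ using Submodule.span_induction with
    | mem θ hθ =>
      obtain ⟨μ, rfl⟩ := hθ
      have hd : Tendsto (fun i => dist (toC (g i)) (toC f) * (μ : Measure X).real univ) l (𝓝 0) := by
        simpa using (tendsto_iff_dist_tendsto_zero.1 h).mul_const ((μ : Measure X).real univ)
      refine tendsto_iff_dist_tendsto_zero.2 (squeeze_zero (fun _ => dist_nonneg) (fun i => ?_) hd)
      rw [dist_eq_norm, ← map_sub, dist_eq_norm, ← map_sub]
      exact norm_integral_le_of_norm_le_const (.of_forall (toC (g i - f)).norm_coe_le_norm)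
    | zero => simpa using tendsto_const_nhds
    | add θ₁ θ₂ _ _ h₁ h₂ => exact h₁.add h₂
    | smul c θ _ h₁ => exact h₁.const_mul c
  rw [Metric.tendsto_nhds]
  intro ε hε
  set B := max C ‖f‖ with hB
  have hB0 : 0 ≤ B := (norm_nonneg f).trans (le_max_right _ _)
  obtain ⟨θ, hθ, hηθ⟩ := Metric.mem_closure_iff.1 hη (ε / (3 * (B + 1))) (by positivity)
  have hclose : ∀ u : Lip X α, ‖u‖ ≤ B → dist (η u) (θ u) < ε / 3 := by
    intro u hu
    rw [dist_eq_norm] at hηθ ⊢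
    calc ‖η u - θ u‖ = ‖(η - θ) u‖ := rfl
      _ ≤ ‖η - θ‖ * ‖u‖ := (η - θ).le_opNorm u
      _ ≤ ‖η - θ‖ * (B + 1) := by gcongr; linarith
      _ < ε / (3 * (B + 1)) * (B + 1) := by gcongr
      _ = ε / 3 := by field_simp
  filter_upwards [Metric.tendsto_nhds.1 (hspan θ hθ) (ε / 3) (by positivity)] with i hi
  have h₁ := hclose (g i) ((hb i).trans (le_max_left _ _))
  have h₂ := hclose f (le_max_right _ _)
  rw [dist_comm] at h₂
  linarith [dist_triangle4 (η (g i)) (θ (g i)) (θ f) (η f)]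

/-- Weak-* convergence implies pointwise convergence, tested on Dirac measures. -/
theorem tendsto_apply_of_tendsto_toDualPredual {ι : Type*} {l : Filter ι} {g : ι → Lip X α}
    {f : Lip X α} (h : Tendsto (fun i => toDualPredual (g i)) l (𝓝 (toDualPredual f))) (x : X) :
    Tendsto (fun i => g i x) l (𝓝 (f x)) := by
  rw [tendsto_iff_forall_eval_tendsto_topDualPairing] at h
  have := h (dirac α x)
  change Tendsto (fun i => pairing (dirac α x) (g i)) l (𝓝 (pairing (dirac α x) f)) at this
  simpa only [pairing_dirac] using this

theorem induced_weakStar_eq_induced_uniformTopology (hα : 0 < α) {s : Set (Lip X α)}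
    (hs : Bornology.IsBounded s) :
    TopologicalSpace.induced (Subtype.val : s → Lip X α) (weakStar X α) =
      TopologicalSpace.induced (Subtype.val : s → Lip X α) (uniformTopology X α) := by
  obtain ⟨C, hC⟩ := isBounded_iff_forall_norm_le.1 hs
  rw [induced_compose, induced_compose]
  refine le_antisymm (continuous_iff_le_induced.1 ?_) (continuous_iff_le_induced.1 ?_)
  · let _ : TopologicalSpace s := TopologicalSpace.induced (toDualPredual ∘ Subtype.val) inferInstance
    refine continuous_iff_continuousAt.2 fun f => ?_
    exact tendsto_toC_of_tendsto_apply hα (fun i : s => hC _ i.2)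
      (tendsto_apply_of_tendsto_toDualPredual (continuous_induced_dom.tendsto f))
  · let _ : TopologicalSpace s := TopologicalSpace.induced (toC ∘ Subtype.val) inferInstance
    refine continuous_iff_continuousAt.2 fun f => ?_
    exact tendsto_toDualPredual (fun i : s => hC _ i.2) (continuous_induced_dom.tendsto f)

end General

/-! ### Dyadic grids and the hat function -/

/-- The dyadic grid of mesh `2^{-k}` in `[0,1]`, as the union of the levels `D_j`, `j ≤ k`. -/
def dyadicGrid (k : ℕ) : Set ℝ := {t | ∃ j ≤ k, t ∈ dyadic j}

theorem dyadicGrid_mono {j k : ℕ} (h : j ≤ k) : dyadicGrid j ⊆ dyadicGrid k :=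
  fun _ ⟨i, hi, ht⟩ => ⟨i, hi.trans h, ht⟩

theorem mem_dyadicGrid_iff {k : ℕ} {t : ℝ} :
    t ∈ dyadicGrid k ↔ ∃ m : ℕ, m ≤ 2 ^ k ∧ t = m * (2 ^ k)⁻¹ := by
  have hs : ∀ (k : ℕ) (a : ℝ), 2 * a * (2 ^ (k + 1))⁻¹ = a * (2 ^ k)⁻¹ := fun k a => by
    rw [pow_succ]; field_simp
  induction k generalizing t with
  | zero =>
    constructor
    · rintro ⟨j, hj, ht⟩
      obtain rfl : j = 0 := by omega
      rcases ht with rfl | rfl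
      · exact ⟨0, by simp⟩
      · exact ⟨1, by simp⟩
    · rintro ⟨m, hm, rfl⟩
      refine ⟨0, le_rfl, ?_⟩
      have : m = 0 ∨ m = 1 := by simp at hm; omega
      rcases this with rfl | rfl
      · exact Or.inl (by simp)
      · exact Or.inr (by simp)
  | succ k ih =>
    constructor
    · rintro ⟨j, hj, ht⟩
      rcases hj.lt_or_eq with hj | rfl
      · obtain ⟨m, hm, rfl⟩ := ih.1 ⟨j, by omega, ht⟩
        refine ⟨2 * m, by rw [pow_succ]; omega, ?_⟩
        push_cast
        exact (hs k m).symm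
      · obtain ⟨p, hp₁, hp₂, rfl⟩ := ht
        refine ⟨2 * p - 1, by rw [pow_succ]; omega, ?_⟩
        rw [Nat.cast_sub (by omega)]
        push_cast
        ring
    · rintro ⟨m, hm, rfl⟩
      rw [pow_succ] at hm
      rcases Nat.even_or_odd' m with ⟨q, rfl | rfl⟩
      · refine dyadicGrid_mono (Nat.le_succ k) (ih.2 ⟨q, by omega, ?_⟩)
        push_cast
        exact hs k q
      · refine ⟨k + 1, le_rfl, q + 1, by omega, by omega, ?_⟩
        push_cast
        ring

theorem dyadicGrid_finite (k : ℕ) : (dyadicGrid k).Finite := by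
  refine ((Set.finite_Iic (2 ^ k)).image fun m : ℕ => (m : ℝ) * (2 ^ k)⁻¹).subset ?_
  intro t ht
  obtain ⟨m, hm, rfl⟩ := mem_dyadicGrid_iff.1 ht
  exact ⟨m, hm, rfl⟩

theorem hat_eq_zero {t : ℝ} (ht : 1 ≤ |t|) : hat t = 0 := by
  rw [hat_eq, max_eq_left (by linarith)]

theorem hat_zero : hat 0 = 1 := by simp [hat_eq]

/-- The hat function is affine between neighbouring points of `ℤ / N`, so that its value at the
midpoint is the mean of the values at the end points. -/
theorem hat_midpoint (p : ℤ) {N : ℕ} (hN : 1 ≤ N) :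
    hat ((p + 1 / 2) / N) = (hat ((p + 1) / N) + hat (p / N)) / 2 := by
  have hN' : (0 : ℝ) < N := by exact_mod_cast hN
  have hneg : ∀ x : ℝ, x ≤ 0 → hat (x / N) = max 0 (1 + x / N) := fun x hx => by
    rw [hat_eq, abs_of_nonpos (div_nonpos_of_nonpos_of_nonneg hx hN'.le), sub_neg_eq_add]
  have hpos : ∀ x : ℝ, 0 ≤ x → hat (x / N) = max 0 (1 - x / N) := fun x hx => by
    rw [hat_eq, abs_of_nonneg (div_nonneg hx hN'.le)]
  rcases lt_or_ge p 0 with hp | hp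
  · have hp' : (p : ℝ) ≤ -1 := by exact_mod_cast (by omega : p ≤ -1)
    rw [hneg _ (by linarith), hneg _ (by linarith), hneg _ (by linarith)]
    rcases lt_or_ge p (-N) with h | h
    · have h' : (p : ℝ) + 1 ≤ -N := by exact_mod_cast (by omega : p + 1 ≤ -(N : ℤ))
      have : ∀ x : ℝ, x ≤ -N → max 0 (1 + x / N) = 0 := fun x hx => by
        refine max_eq_left ?_
        have : x / N ≤ -1 := by rw [div_le_iff₀ hN']; linarith
        linarith
      rw [this _ (by linarith), this _ (by linarith), this _ (by linarith)]
      norm_num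
    · have h' : -(N : ℝ) ≤ p := by exact_mod_cast h
      have : ∀ x : ℝ, -N ≤ x → max 0 (1 + x / N) = 1 + x / N := fun x hx => by
        refine max_eq_right ?_
        have : -1 ≤ x / N := by rw [le_div_iff₀ hN']; linarith
        linarith
      rw [this _ (by linarith), this _ (by linarith), this _ (by linarith)]
      ring
  · have hp' : (0 : ℝ) ≤ p := by exact_mod_cast hp
    rw [hpos _ (by linarith), hpos _ (by linarith), hpos _ (by linarith)]
    rcases lt_or_ge p N with h | h
    · have h' : (p : ℝ) + 1 ≤ N := by exact_mod_cast (by omega : p + 1 ≤ (N : ℤ))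
      have : ∀ x : ℝ, x ≤ N → max 0 (1 - x / N) = 1 - x / N := fun x hx => by
        refine max_eq_right ?_
        have : x / N ≤ 1 := by rw [div_le_iff₀ hN']; linarith
        linarith
      rw [this _ (by linarith), this _ (by linarith), this _ (by linarith)]
      ring
    · have h' : (N : ℝ) ≤ p := by exact_mod_cast h
      have : ∀ x : ℝ, N ≤ x → max 0 (1 - x / N) = 0 := fun x hx => by
        refine max_eq_left ?_
        have : 1 ≤ x / N := by rw [le_div_iff₀ hN']; linarith
        linarith
      rw [this _ (by linarith), this _ (by linarith), this _ (by linarith)]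
      norm_num

theorem hat_mul_sub_eq_zero {k : ℕ} {s t : ℝ} (hs : s ∈ dyadicGrid k) (ht : t ∈ dyadicGrid k)
    (hst : t ≠ s) : hat (2 ^ k * (t - s)) = 0 := by
  obtain ⟨a, -, rfl⟩ := mem_dyadicGrid_iff.1 hs
  obtain ⟨b, -, rfl⟩ := mem_dyadicGrid_iff.1 ht
  have hab : (b : ℤ) - a ≠ 0 := by
    intro h
    obtain rfl : b = a := by omega
    exact hst rfl
  have h : (2 : ℝ) ^ k * (b * (2 ^ k)⁻¹ - a * (2 ^ k)⁻¹) = ((b - a : ℤ) : ℝ) := by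
    push_cast; field_simp
  rw [h]
  refine hat_eq_zero ?_
  exact_mod_cast Int.one_le_abs hab

theorem dyadic_add_sub_mem_dyadicGrid {k : ℕ} {t : ℝ} (ht : t ∈ dyadic (k + 1)) :
    t + (2 ^ (k + 1))⁻¹ ∈ dyadicGrid k ∧ t - (2 ^ (k + 1))⁻¹ ∈ dyadicGrid k := by
  obtain ⟨p, hp₁, hp₂, rfl⟩ := ht
  rw [mem_dyadicGrid_iff, mem_dyadicGrid_iff]
  refine ⟨⟨p, hp₂, ?_⟩, ⟨p - 1, by omega, ?_⟩⟩
  · rw [pow_succ]; field_simp; ring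
  · rw [pow_succ, Nat.cast_sub hp₁]; push_cast; field_simp; ring

theorem hat_mul_sub_eq_mean {j k : ℕ} (hjk : j ≤ k) {s t : ℝ} (hs : s ∈ dyadicGrid j)
    (ht : t ∈ dyadic (k + 1)) :
    hat (2 ^ j * (t - s)) = (hat (2 ^ j * (t + (2 ^ (k + 1))⁻¹ - s)) +
      hat (2 ^ j * (t - (2 ^ (k + 1))⁻¹ - s))) / 2 := by
  obtain ⟨d, rfl⟩ := Nat.exists_eq_add_of_le hjk
  obtain ⟨a, -, rfl⟩ := mem_dyadicGrid_iff.1 hs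
  obtain ⟨p, hp₁, hp₂, rfl⟩ := ht
  have h := hat_midpoint ((p : ℤ) - 1 - 2 ^ d * a) (N := 2 ^ d) Nat.one_le_two_pow
  push_cast at h
  have h₀ : (2 : ℝ) ^ j * ((2 * p - 1) * (2 ^ (j + d + 1))⁻¹ - a * (2 ^ j)⁻¹) =
      ((p : ℝ) - 1 - 2 ^ d * a + 1 / 2) / 2 ^ d := by
    rw [pow_succ, pow_add]; field_simp; ring
  have h₁ : (2 : ℝ) ^ j * ((2 * p - 1) * (2 ^ (j + d + 1))⁻¹ + (2 ^ (j + d + 1))⁻¹ -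
      a * (2 ^ j)⁻¹) = ((p : ℝ) - 1 - 2 ^ d * a + 1) / 2 ^ d := by
    rw [pow_succ, pow_add]; field_simp; ring
  have h₂ : (2 : ℝ) ^ j * ((2 * p - 1) * (2 ^ (j + d + 1))⁻¹ - (2 ^ (j + d + 1))⁻¹ -
      a * (2 ^ j)⁻¹) = ((p : ℝ) - 1 - 2 ^ d * a) / 2 ^ d := by
    rw [pow_succ, pow_add]; field_simp; ring
  rw [h₀, h₁, h₂, h]

/-! ### The Faber–Schauder functions of one level -/

section Levels

variable {n : ℕ}

theorem dyadicMulti_finite (n k : ℕ) : (dyadicMulti n k).Finite :=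
  (Set.Finite.pi fun _ : Fin n => dyadicGrid_finite k).subset fun _ hτ i _ => hτ.1 i

instance (n k : ℕ) : Fintype (dyadicMulti n k) := (dyadicMulti_finite n k).fintype

/-- The indices whose level lies in a given finite set. -/
def levels (n : ℕ) (s : Finset ℕ) : Finset (Index n) := s.sigma fun _ => Finset.univ

theorem mem_levels {s : Finset ℕ} {τ : Index n} : τ ∈ levels n s ↔ τ.1 ∈ s := by
  simp [levels]

theorem schauderC_apply (τ : Index n) (x : Cube n) :
    schauderC τ x = ∏ i, hat (2 ^ τ.1 * (x.1 i - τ.2.1 i)) := rfl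

theorem schauderC_mem_Icc (τ : Index n) (x : Cube n) : schauderC τ x ∈ Icc (0 : ℝ) 1 := by
  rw [schauderC_apply]
  exact ⟨Finset.prod_nonneg fun _ _ => (hat_mem _).1,
    Finset.prod_le_one (fun _ _ => (hat_mem _).1) fun _ _ => (hat_mem _).2⟩

theorem abs_schauderC_sub_le (τ : Index n) (x y : Cube n) :
    |schauderC τ x - schauderC τ y| ≤ n * (2 ^ τ.1 * dist x y) := by
  rw [schauderC_apply, schauderC_apply]
  refine (abs_prod_sub_prod_le Finset.univ _ _ (fun i => hat_mem _) fun i => hat_mem _).trans ?_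
  have : ∀ i ∈ Finset.univ, |hat (2 ^ τ.1 * (x.1 i - τ.2.1 i)) -
      hat (2 ^ τ.1 * (y.1 i - τ.2.1 i))| ≤ 2 ^ τ.1 * dist x y := by
    intro i _
    refine (hat_lipschitz _ _).trans ?_
    rw [← mul_sub, abs_mul, abs_of_pos (by positivity : (0 : ℝ) < 2 ^ τ.1),
      sub_sub_sub_cancel_right]
    refine mul_le_mul_of_nonneg_left ?_ (by positivity)
    have := PiLp.norm_apply_le (x.1 - y.1) i
    rwa [← dist_eq_norm] at this
  refine (Finset.sum_le_card_nsmul _ _ _ this).trans ?_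
  simp

/-- At each point at most `2^n` functions of a given level do not vanish: the scaled coordinates
of their nodes are roundings of those of the point. -/
theorem card_schauderC_ne_zero_le (k : ℕ) (x : Cube n) :
    (Finset.univ.filter fun τ : dyadicMulti n k => schauderC ⟨k, τ⟩ x ≠ 0).card ≤ 2 ^ n := by
  classical
  set A : Fin n → Finset ℝ := fun i =>
    ({(⌊2 ^ k * x.1 i⌋ : ℝ) * (2 ^ k)⁻¹, ((⌊2 ^ k * x.1 i⌋ : ℝ) + 1) * (2 ^ k)⁻¹} : Finset ℝ)
  have hA : (Fintype.piFinset A).card ≤ 2 ^ n := by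
    rw [Fintype.card_piFinset]
    refine (Finset.prod_le_pow_card Finset.univ _ 2 fun i _ => Finset.card_le_two).trans ?_
    simp
  refine (Finset.card_le_card_of_injOn (fun τ => τ.1) ?_ fun _ _ _ _ h => Subtype.ext h).trans hA
  intro τ hτ
  rw [Finset.mem_coe, Finset.mem_filter, schauderC_apply] at hτ
  rw [Finset.mem_coe, Fintype.mem_piFinset]
  intro i
  have hi : hat (2 ^ k * (x.1 i - τ.1 i)) ≠ 0 :=
    (Finset.prod_ne_zero_iff.1 hτ.2) i (Finset.mem_univ i)
  obtain ⟨m, -, hm⟩ := mem_dyadicGrid_iff.1 (τ.2.1 i)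
  have hlt : |2 ^ k * (x.1 i - τ.1 i)| < 1 := by
    by_contra! h
    exact hi (hat_eq_zero h)
  have heq : 2 ^ k * (x.1 i - τ.1 i) = 2 ^ k * x.1 i - m := by
    rw [hm]; field_simp
  rw [heq, abs_lt] at hlt
  have h₁ : (m : ℤ) ≤ ⌊2 ^ k * x.1 i⌋ + 1 := by
    have : (m : ℝ) < (⌊2 ^ k * x.1 i⌋ + 1 : ℤ) + 1 := by
      push_cast
      linarith [Int.lt_floor_add_one (2 ^ k * x.1 i)]
    have : (m : ℤ) < (⌊2 ^ k * x.1 i⌋ + 1) + 1 := by exact_mod_cast this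
    omega
  have h₂ : ⌊2 ^ k * x.1 i⌋ ≤ (m : ℤ) := by
    have : (⌊2 ^ k * x.1 i⌋ : ℝ) < (m : ℤ) + 1 := by
      push_cast
      linarith [Int.floor_le (2 ^ k * x.1 i)]
    have : ⌊2 ^ k * x.1 i⌋ < (m : ℤ) + 1 := by exact_mod_cast this
    omega
  have h₃ : ⌊2 ^ k * x.1 i⌋ = m ∨ ⌊2 ^ k * x.1 i⌋ + 1 = (m : ℤ) := by omega
  rw [Finset.mem_insert, Finset.mem_singleton]
  change τ.1 i = _ ∨ τ.1 i = _
  rw [hm]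
  rcases h₃ with h | h
  · left; rw [h]; push_cast; rfl
  · right
    have : (m : ℝ) = ⌊2 ^ k * x.1 i⌋ + 1 := by exact_mod_cast h.symm
    rw [this]

theorem sum_schauderC_le (k : ℕ) (x : Cube n) :
    ∑ τ : dyadicMulti n k, schauderC ⟨k, τ⟩ x ≤ 2 ^ n := by
  classical
  rw [← Finset.sum_filter_ne_zero]
  refine (Finset.sum_le_card_nsmul _ _ 1 fun τ _ => (schauderC_mem_Icc _ x).2).trans ?_
  rw [nsmul_eq_mul, mul_one]
  exact_mod_cast card_schauderC_ne_zero_le k x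

theorem sum_abs_schauderC_sub_le (k : ℕ) (x y : Cube n) :
    ∑ τ : dyadicMulti n k, |schauderC ⟨k, τ⟩ x - schauderC ⟨k, τ⟩ y| ≤
      2 * 2 ^ n * min 1 (n * (2 ^ k * dist x y)) := by
  classical
  set S : Cube n → Finset (dyadicMulti n k) := fun x =>
    Finset.univ.filter fun τ : dyadicMulti n k => schauderC ⟨k, τ⟩ x ≠ 0
  have hS : ∑ τ : dyadicMulti n k, |schauderC ⟨k, τ⟩ x - schauderC ⟨k, τ⟩ y| =
      ∑ τ ∈ S x ∪ S y, |schauderC ⟨k, τ⟩ x - schauderC ⟨k, τ⟩ y| := by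
    refine (Finset.sum_subset (Finset.subset_univ _) fun τ _ hτ => ?_).symm
    simp only [S, Finset.mem_union, Finset.mem_filter, Finset.mem_univ, true_and, not_or,
      not_not] at hτ
    rw [hτ.1, hτ.2, sub_zero, abs_zero]
  have hcard : ((S x ∪ S y).card : ℝ) ≤ 2 * 2 ^ n := by
    have := (Finset.card_union_le (S x) (S y)).trans
      (add_le_add (card_schauderC_ne_zero_le k x) (card_schauderC_ne_zero_le k y))
    rw [← two_mul] at this
    exact_mod_cast this
  rw [hS]
  refine (Finset.sum_le_card_nsmul _ _ (min 1 (n * (2 ^ k * dist x y))) fun τ _ => ?_).trans ?_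
  · refine le_min ?_ (abs_schauderC_sub_le ⟨k, τ⟩ x y)
    have h₁ := schauderC_mem_Icc ⟨k, τ⟩ x
    have h₂ := schauderC_mem_Icc ⟨k, τ⟩ y
    exact abs_le.2 ⟨by linarith [h₁.1, h₂.2], by linarith [h₁.2, h₂.1]⟩
  · rw [nsmul_eq_mul]
    exact mul_le_mul_of_nonneg_right hcard (le_min zero_le_one (by positivity))

end Levels

/-! ### Hierarchical interpolation -/

section Interpolation

variable {n : ℕ} {α : ℝ≥0}

theorem Cube.dist_le_of_abs_sub_le {x y : Cube n} {h : ℝ} (hxy : ∀ i, |x.1 i - y.1 i| ≤ h)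
    (hh : 0 ≤ h) : dist x y ≤ √n * h := by
  rw [Subtype.dist_eq, EuclideanSpace.dist_eq]
  have : ∑ i, dist (x.1 i) (y.1 i) ^ 2 ≤ n * h ^ 2 := by
    refine (Finset.sum_le_card_nsmul _ _ (h ^ 2) fun i _ => ?_).trans (by simp)
    rw [Real.dist_eq]
    exact pow_le_pow_left₀ (abs_nonneg _) (hxy i) 2
  refine (Real.sqrt_le_sqrt this).trans_eq ?_
  rw [Real.sqrt_mul (Nat.cast_nonneg n), Real.sqrt_sq hh]

theorem dist_node_neighbour_le {k : ℕ} (τ : dyadicMulti n (k + 1)) (ε : Fin n → ℤˣ) :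
    dist (node τ) (neighbour τ ε) ≤ √n * (2 ^ (k + 1))⁻¹ := by
  classical
  refine Cube.dist_le_of_abs_sub_le (fun i => ?_) (by positivity)
  change |τ.1 i - (if τ.1 i ∈ dyadic (k + 1) then _ else _)| ≤ _
  split_ifs
  · rcases Int.units_eq_one_or (ε i) with h | h <;> simp [h]
  · simp

theorem neighbour_mem_dyadicGrid {k : ℕ} (τ : dyadicMulti n (k + 1)) (ε : Fin n → ℤˣ) (i : Fin n) :
    (neighbour τ ε).1 i ∈ dyadicGrid k := by
  classical
  change (if τ.1 i ∈ dyadic (k + 1) then τ.1 i + ((ε i : ℤ) : ℝ) * (2 ^ (k + 1))⁻¹ else τ.1 i) ∈ _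
  split_ifs with h
  · have := dyadic_add_sub_mem_dyadicGrid h
    rcases Int.units_eq_one_or (ε i) with he | he
    · simpa [he] using this.1
    · simpa [he, ← sub_eq_add_neg] using this.2
  · obtain ⟨j, hj, hτ⟩ := τ.2.1 i
    have : j ≠ k + 1 := fun hjk => h (hjk ▸ hτ)
    exact ⟨j, by omega, hτ⟩

theorem schauderC_node (τ : Index n) : schauderC τ (node τ.2) = 1 := by
  rw [schauderC_apply]
  refine Finset.prod_eq_one fun i _ => ?_
  change hat (2 ^ τ.1 * (τ.2.1 i - τ.2.1 i)) = 1
  rw [sub_self, mul_zero, hat_zero]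

theorem schauderC_eq_zero {k : ℕ} (τ : dyadicMulti n k) {x : Cube n}
    (hx : ∀ i, x.1 i ∈ dyadicGrid k) (hne : ∃ i, x.1 i ≠ τ.1 i) : schauderC ⟨k, τ⟩ x = 0 := by
  obtain ⟨i, hi⟩ := hne
  rw [schauderC_apply]
  exact Finset.prod_eq_zero (Finset.mem_univ i) (hat_mul_sub_eq_zero (τ.2.1 i) (hx i) hi)

/-- A function of level at most `k` is affine in each coordinate between neighbouring points of
the grid of mesh `2^{-k}`, so that its value at a node of level `k + 1` is the mean of the values
at the neighbours of the node. -/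
theorem schauderC_node_eq_mean {k : ℕ} (σ : Index n) (hσ : σ.1 ≤ k) (τ : dyadicMulti n (k + 1)) :
    schauderC σ (node τ) = (2 ^ n)⁻¹ * ∑ ε : Fin n → ℤˣ, schauderC σ (neighbour τ ε) := by
  classical
  obtain ⟨j, σ⟩ := σ
  set b : Fin n → ℤˣ → ℝ := fun i e =>
    if τ.1 i ∈ dyadic (k + 1) then τ.1 i + ((e : ℤ) : ℝ) * (2 ^ (k + 1))⁻¹ else τ.1 i
  have h₁ : ∀ i, hat (2 ^ j * (τ.1 i - σ.1 i)) =
      2⁻¹ * ∑ e : ℤˣ, hat (2 ^ j * (b i e - σ.1 i)) := by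
    intro i
    rw [UnitsInt.univ, Finset.sum_pair (by decide)]
    by_cases h : τ.1 i ∈ dyadic (k + 1)
    · rw [hat_mul_sub_eq_mean hσ (σ.2.1 i) h]
      simp only [b, if_pos h]
      push_cast
      rw [one_mul, neg_one_mul, ← sub_eq_add_neg]
      ring
    · simp only [b, if_neg h]
      ring
  calc schauderC ⟨j, σ⟩ (node τ) = ∏ i, hat (2 ^ j * (τ.1 i - σ.1 i)) := rfl
    _ = ∏ i, 2⁻¹ * ∑ e : ℤˣ, hat (2 ^ j * (b i e - σ.1 i)) :=
      Finset.prod_congr rfl fun i _ => h₁ i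
    _ = (2 ^ n)⁻¹ * ∑ ε : Fin n → ℤˣ, ∏ i, hat (2 ^ j * (b i (ε i) - σ.1 i)) := by
      rw [Finset.prod_mul_distrib, Finset.prod_univ_sum, Fintype.piFinset_univ]
      simp
    _ = _ := rfl

theorem sum_smul_schauderNormalised_apply (hα : α ≤ 1) (c : Index n → ℝ) (F : Finset (Index n))
    (x : Cube n) : (∑ τ ∈ F, c τ • schauderNormalised hα τ) x =
      ∑ τ ∈ F, c τ * ((2 : ℝ) ^ (-(α : ℝ) * τ.1) * schauderC τ x) := by
  change toC (∑ τ ∈ F, c τ • schauderNormalised hα τ) x = _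
  rw [map_sum, ContinuousMap.sum_apply]
  rfl

theorem partialSum_apply (hα : α ≤ 1) (f : Lip (Cube n) α) (F : Finset (Index n)) (x : Cube n) :
    partialSum hα f F x = ∑ τ ∈ F, pairing (coeffNormalised α τ) f *
      ((2 : ℝ) ^ (-(α : ℝ) * τ.1) * schauderC τ x) :=
  sum_smul_schauderNormalised_apply hα _ F x

theorem partialSum_node_eq_mean (hα : α ≤ 1) (f : Lip (Cube n) α) {k : ℕ} {F : Finset (Index n)}
    (hF : ∀ σ ∈ F, σ.1 ≤ k) (τ : dyadicMulti n (k + 1)) :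
    partialSum hα f F (node τ) =
      (2 ^ n)⁻¹ * ∑ ε : Fin n → ℤˣ, partialSum hα f F (neighbour τ ε) := by
  simp only [partialSum_apply]
  rw [Finset.sum_comm, Finset.mul_sum]
  refine Finset.sum_congr rfl fun σ hσ => ?_
  rw [schauderC_node_eq_mean σ (hF σ hσ) τ, ← Finset.mul_sum, ← Finset.mul_sum]
  ring

theorem partialSum_levels_range_succ (hα : α ≤ 1) (f : Lip (Cube n) α) (k : ℕ) (x : Cube n) :
    partialSum hα f (levels n (Finset.range (k + 1))) x =
      partialSum hα f (levels n (Finset.range k)) x +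
        ∑ τ : dyadicMulti n k, pairing (coeffNormalised α ⟨k, τ⟩) f *
          ((2 : ℝ) ^ (-(α : ℝ) * k) * schauderC ⟨k, τ⟩ x) := by
  rw [partialSum_apply, partialSum_apply, levels, levels, Finset.sum_sigma, Finset.sum_sigma,
    Finset.sum_range_succ]

/-- The coefficient of a node of level `k + 1` corrects the mean of the neighbouring values to the
value at the node. -/
theorem pairing_coeffNormalised_mul_rpow {k : ℕ} (τ : dyadicMulti n (k + 1))
    (f : Lip (Cube n) α) :
    pairing (coeffNormalised α ⟨k + 1, τ⟩) f * (2 : ℝ) ^ (-(α : ℝ) * (k + 1 : ℕ)) =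
      f (node τ) - (2 ^ n)⁻¹ * ∑ ε : Fin n → ℤˣ, f (neighbour τ ε) := by
  have h : (2 : ℝ) ^ ((α : ℝ) * ((k + 1 : ℕ) : ℝ) - n) * (2 : ℝ) ^ (-(α : ℝ) * (k + 1 : ℕ)) =
      (2 ^ n)⁻¹ := by
    rw [← Real.rpow_add two_pos, ← Real.rpow_natCast 2 n, ← Real.rpow_neg two_pos.le]
    congr 1
    ring
  rw [pairing_coeffNormalised_succ, mul_right_comm, h, Finset.sum_sub_distrib, mul_sub]
  congr 1
  simp

/-- The sum over the levels up to `k` interpolates `f` on the grid of mesh `2^{-k}`. -/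
theorem partialSum_levels_eq_on_dyadicGrid (hn : 1 ≤ n) (hα : α ≤ 1) (f : Lip (Cube n) α) (k : ℕ)
    (x : Cube n) (hx : ∀ i, x.1 i ∈ dyadicGrid k) :
    partialSum hα f (levels n (Finset.range (k + 1))) x = f x := by
  -- At a grid point only the function with node at this point survives on the finest level.
  have hsingle : ∀ {k : ℕ} (c : dyadicMulti n k → ℝ) (τ : dyadicMulti n k),
      ∑ σ : dyadicMulti n k, c σ * ((2 : ℝ) ^ (-(α : ℝ) * k) * schauderC ⟨k, σ⟩ (node τ)) =
        c τ * (2 : ℝ) ^ (-(α : ℝ) * k) := by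
    intro k c τ
    rw [Finset.sum_eq_single τ]
    · have := schauderC_node ⟨k, τ⟩
      rw [show schauderC ⟨k, τ⟩ (node τ) = 1 from this, mul_one]
    · intro σ _ hσ
      rw [schauderC_eq_zero σ (x := node τ) τ.2.1, mul_zero, mul_zero]
      by_contra! h
      exact hσ (Subtype.ext (funext h).symm)
    · simp
  rw [partialSum_levels_range_succ]
  induction k generalizing x with
  | zero =>
    have hτ : x.1.ofLp ∈ dyadicMulti n 0 := by
      refine ⟨hx, ⟨0, hn⟩, ?_⟩
      obtain ⟨j, hj, h⟩ := hx ⟨0, hn⟩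
      rwa [Nat.le_zero.1 hj] at h
    have hxτ : x = node ⟨x.1.ofLp, hτ⟩ := rfl
    rw [hxτ, hsingle (fun σ => pairing (coeffNormalised α ⟨0, σ⟩) f),
      pairing_coeffNormalised_zero, partialSum_apply, levels, Finset.sum_sigma]
    simp
  | succ k ih =>
    by_cases hk : ∀ i, x.1 i ∈ dyadicGrid k
    · rw [partialSum_levels_range_succ, ih x hk, Finset.sum_eq_zero, add_zero]
      intro τ _
      rw [schauderC_eq_zero τ hx, mul_zero, mul_zero]
      obtain ⟨i, hi⟩ := τ.2.2
      refine ⟨i, fun h => ?_⟩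
      obtain ⟨j, hj, h'⟩ := hk i
      exact dyadic_disjoint (Nat.lt_succ_of_le hj) (h ▸ h') hi
    · have hτ : x.1.ofLp ∈ dyadicMulti n (k + 1) := by
        refine ⟨hx, ?_⟩
        push Not at hk
        obtain ⟨i, hi⟩ := hk
        obtain ⟨j, hj, h⟩ := hx i
        have : j = k + 1 := by
          by_contra hne
          exact hi ⟨j, by omega, h⟩
        exact ⟨i, this ▸ h⟩
      have hxτ : x = node ⟨x.1.ofLp, hτ⟩ := rfl
      rw [hxτ, hsingle (fun σ => pairing (coeffNormalised α ⟨k + 1, σ⟩) f),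
        pairing_coeffNormalised_mul_rpow, partialSum_node_eq_mean hα f (k := k)
          fun σ hσ => Nat.lt_succ_iff.1 (Finset.mem_range.1 (mem_levels.1 hσ))]
      have hmean : ∀ ε, partialSum hα f (levels n (Finset.range (k + 1)))
          (neighbour ⟨x.1.ofLp, hτ⟩ ε) = f (neighbour ⟨x.1.ofLp, hτ⟩ ε) := fun ε => by
        rw [partialSum_levels_range_succ]
        exact ih _ (neighbour_mem_dyadicGrid _ ε)
      simp only [hmean]
      ring

end Interpolation

/-! ### Norm estimates for finite sums -/

theorem sum_range_pow_le {r : ℝ} (h₀ : 0 ≤ r) (h₁ : r < 1) (N : ℕ) :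
    ∑ i ∈ Finset.range N, r ^ i ≤ (1 - r)⁻¹ := by
  rw [← tsum_geometric_of_lt_one h₀ h₁]
  exact (summable_geometric_of_lt_one h₀ h₁).sum_le_tsum _ fun _ _ => pow_nonneg h₀ _

theorem two_rpow_neg_lt_one {a : ℝ} (ha : 0 < a) : (2 : ℝ) ^ (-a) < 1 :=
  Real.rpow_lt_one_of_one_lt_of_neg one_lt_two (neg_lt_zero.2 ha)

/-- The levels `k` with `2^k d ≤ 1` and those with `2^k d > 1` are each dominated by a geometric
series. -/
theorem sum_rpow_mul_min_le {a d : ℝ} (ha₀ : 0 < a) (ha₁ : a < 1) (hd : 0 < d) (N : ℕ) :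
    ∑ k ∈ Finset.range N, (2 : ℝ) ^ (-a * k) * min 1 (2 ^ k * d) ≤
      ((1 - 2 ^ (-(1 - a)))⁻¹ + (1 - 2 ^ (-a))⁻¹) * d ^ a := by
  have hex : ∃ K : ℕ, 1 < 2 ^ K * d := by
    obtain ⟨K, hK⟩ := pow_unbounded_of_one_lt d⁻¹ (one_lt_two : (1 : ℝ) < 2)
    exact ⟨K, by rwa [inv_lt_iff_one_lt_mul₀ hd] at hK⟩
  classical
  -- `K` is the first level whose mesh is below `d`.
  set K := Nat.find hex
  have hK : 1 < 2 ^ K * d := Nat.find_spec hex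
  have hlt : ∀ k < K, 2 ^ k * d ≤ 1 := fun k hk => not_lt.1 (Nat.find_min hex hk)
  have hterm : ∀ k : ℕ, 0 ≤ (2 : ℝ) ^ (-a * k) * min 1 (2 ^ k * d) := fun k =>
    mul_nonneg (by positivity) (le_min zero_le_one (by positivity))
  have hpow : ∀ (b : ℝ) (i : ℕ), (2 : ℝ) ^ (-b * i) = ((2 : ℝ) ^ (-b)) ^ i := fun b i =>
    Real.rpow_mul_natCast two_pos.le _ _
  have hpow' : ∀ (b : ℝ) (i : ℕ), (2 : ℝ) ^ (-b * i) = ((2 ^ i)⁻¹ : ℝ) ^ b := fun b i => by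
    rw [← Real.rpow_natCast, ← Real.rpow_neg two_pos.le, ← Real.rpow_mul two_pos.le]
    congr 1
    ring
  have hlow : ∑ k ∈ Finset.range K, (2 : ℝ) ^ (-a * k) * min 1 (2 ^ k * d) ≤
      (1 - 2 ^ (-(1 - a)))⁻¹ * d ^ a := by
    -- Counted downwards from `K - 1`, the low levels decay geometrically because `a < 1`.
    rw [← Finset.sum_range_reflect]
    refine (Finset.sum_le_sum fun j hj => ?_).trans (?_ :
      ∑ j ∈ Finset.range K, ((2 : ℝ) ^ (-(1 - a))) ^ j * d ^ a ≤ _)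
    · have hj' := Finset.mem_range.1 hj
      set k := K - 1 - j
      have hkj : 2 ^ k * d ≤ (2 ^ j)⁻¹ := by
        have := hlt (k + j) (by omega)
        rw [pow_add] at this
        rw [← one_div, le_div_iff₀ (by positivity)]
        linarith
      calc (2 : ℝ) ^ (-a * k) * min 1 (2 ^ k * d) ≤ (2 : ℝ) ^ (-a * k) * (2 ^ k * d) := by
            gcongr; exact min_le_right _ _
        _ = (2 ^ k * d) ^ (1 - a) * d ^ a := by
            rw [Real.rpow_sub (by positivity), Real.rpow_one, hpow',
              Real.mul_rpow (by positivity) hd.le, Real.inv_rpow (by positivity)]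
            have h₁ : d ^ a ≠ 0 := (Real.rpow_pos_of_pos hd _).ne'
            have h₂ : ((2 : ℝ) ^ k) ^ a ≠ 0 := (Real.rpow_pos_of_pos (by positivity) _).ne'
            field_simp
        _ ≤ ((2 ^ j)⁻¹) ^ (1 - a) * d ^ a := by
            gcongr
        _ = ((2 : ℝ) ^ (-(1 - a))) ^ j * d ^ a := by rw [← hpow', hpow]
    · rw [← Finset.sum_mul]
      gcongr
      exact sum_range_pow_le (by positivity) (two_rpow_neg_lt_one (by linarith)) K
  have hhigh : ∑ i ∈ Finset.range N, (2 : ℝ) ^ (-a * (K + i : ℕ)) * min 1 (2 ^ (K + i) * d) ≤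
      (1 - 2 ^ (-a))⁻¹ * d ^ a := by
    refine (Finset.sum_le_sum fun i hi => ?_).trans (?_ :
      ∑ i ∈ Finset.range N, ((2 : ℝ) ^ (-a)) ^ i * d ^ a ≤ _)
    · calc (2 : ℝ) ^ (-a * (K + i : ℕ)) * min 1 (2 ^ (K + i) * d)
          ≤ (2 : ℝ) ^ (-a * (K + i : ℕ)) * 1 := by gcongr; exact min_le_left _ _
        _ = ((2 : ℝ) ^ (-a)) ^ i * ((2 ^ K)⁻¹ : ℝ) ^ a := by
            rw [mul_one, hpow, pow_add, mul_comm, ← hpow a K, hpow']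
        _ ≤ ((2 : ℝ) ^ (-a)) ^ i * d ^ a := by
            gcongr
            rw [inv_le_iff_one_le_mul₀' (by positivity)]
            exact hK.le
    · rw [← Finset.sum_mul]
      gcongr
      exact sum_range_pow_le (by positivity) (two_rpow_neg_lt_one ha₀) N
  calc _ ≤ ∑ k ∈ Finset.range (K + N), (2 : ℝ) ^ (-a * k) * min 1 (2 ^ k * d) :=
        Finset.sum_le_sum_of_subset_of_nonneg (Finset.range_mono (Nat.le_add_left N K))
          fun k _ _ => hterm k
    _ ≤ _ := by
      rw [Finset.sum_range_add, add_mul]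
      exact add_le_add hlow hhigh

section Estimates

variable {n : ℕ} {α : ℝ≥0}

theorem exists_subset_levels_Ico {F : Finset (Index n)} {K : ℕ} (hF : ∀ τ ∈ F, K ≤ τ.1) :
    ∃ N, F ⊆ levels n (Finset.Ico K (K + N)) := by
  obtain ⟨N, hN⟩ := (F.image fun τ => τ.1).exists_nat_subset_range
  refine ⟨N, fun τ hτ => mem_levels.2 (Finset.mem_Ico.2 ⟨hF τ hτ, ?_⟩)⟩
  have := Finset.mem_range.1 (hN (Finset.mem_image_of_mem _ hτ))
  omega

/-- A sum over indices of level at least `K` is uniformly of order `2^{-αK}`, as each level `k`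
contributes at most `2^n 2^{-αk}`. -/
theorem abs_sum_smul_schauderNormalised_apply_le (hα0 : 0 < α) (hα : α ≤ 1) {c : Index n → ℝ}
    {F : Finset (Index n)} {K : ℕ} {M : ℝ} (hM : 0 ≤ M) (hF : ∀ τ ∈ F, K ≤ τ.1)
    (hc : ∀ τ ∈ F, |c τ| ≤ M) (x : Cube n) :
    |(∑ τ ∈ F, c τ • schauderNormalised hα τ) x| ≤
      2 ^ n * (1 - 2 ^ (-(α : ℝ)))⁻¹ * M * ((2 : ℝ) ^ (-(α : ℝ))) ^ K := by
  obtain ⟨N, hN⟩ := exists_subset_levels_Ico hF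
  have hpow : ∀ i : ℕ, (2 : ℝ) ^ (-(α : ℝ) * i) = ((2 : ℝ) ^ (-(α : ℝ))) ^ i := fun i =>
    Real.rpow_mul_natCast two_pos.le _ _
  rw [sum_smul_schauderNormalised_apply]
  calc |∑ τ ∈ F, c τ * ((2 : ℝ) ^ (-(α : ℝ) * τ.1) * schauderC τ x)|
      ≤ ∑ τ ∈ F, M * ((2 : ℝ) ^ (-(α : ℝ) * τ.1) * schauderC τ x) := by
        refine (Finset.abs_sum_le_sum_abs _ _).trans (Finset.sum_le_sum fun τ hτ => ?_)
        have := (schauderC_mem_Icc τ x).1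
        rw [abs_mul, abs_of_nonneg (by positivity : 0 ≤ (2 : ℝ) ^ (-(α : ℝ) * τ.1) * schauderC τ x)]
        gcongr
        exact hc τ hτ
    _ ≤ ∑ τ ∈ levels n (Finset.Ico K (K + N)),
          M * ((2 : ℝ) ^ (-(α : ℝ) * τ.1) * schauderC τ x) := by
        refine Finset.sum_le_sum_of_subset_of_nonneg hN fun τ _ _ => ?_
        have := (schauderC_mem_Icc τ x).1
        positivity
    _ = ∑ k ∈ Finset.Ico K (K + N),
          M * ((2 : ℝ) ^ (-(α : ℝ) * k) * ∑ τ : dyadicMulti n k, schauderC ⟨k, τ⟩ x) := by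
        rw [levels, Finset.sum_sigma]
        simp only [Finset.mul_sum]
    _ ≤ ∑ k ∈ Finset.Ico K (K + N), M * ((2 : ℝ) ^ (-(α : ℝ) * k) * 2 ^ n) := by
        gcongr with k
        exact sum_schauderC_le k x
    _ = 2 ^ n * M * ((2 : ℝ) ^ (-(α : ℝ))) ^ K *
          ∑ i ∈ Finset.range N, ((2 : ℝ) ^ (-(α : ℝ))) ^ i := by
        rw [Finset.sum_Ico_eq_sum_range, Nat.add_sub_cancel_left, Finset.mul_sum]
        refine Finset.sum_congr rfl fun i _ => ?_
        rw [hpow, pow_add]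
        ring
    _ ≤ 2 ^ n * M * ((2 : ℝ) ^ (-(α : ℝ))) ^ K * (1 - 2 ^ (-(α : ℝ)))⁻¹ := by
        gcongr
        exact sum_range_pow_le (by positivity) (two_rpow_neg_lt_one (by exact_mod_cast hα0)) N
    _ = _ := by ring

/-- The renormalised Faber–Schauder functions satisfy an upper `c₀`-estimate: the Lipschitz norm
of a finite linear combination is controlled by its largest coefficient. -/
theorem exists_norm_sum_smul_schauderNormalised_le (hn : 1 ≤ n) (hα0 : 0 < α) (hα1 : α < 1) :
    ∃ C : ℝ, 0 ≤ C ∧ ∀ (c : Index n → ℝ) (F : Finset (Index n)) (M : ℝ), 0 ≤ M →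
      (∀ τ ∈ F, |c τ| ≤ M) → ‖∑ τ ∈ F, c τ • schauderNormalised hα1.le τ‖ ≤ C * M := by
  have hα0' : (0 : ℝ) < α := by exact_mod_cast hα0
  have hα1' : (α : ℝ) < 1 := by exact_mod_cast hα1
  have hn' : (1 : ℝ) ≤ n := by exact_mod_cast hn
  set G : ℝ := (1 - 2 ^ (-(1 - (α : ℝ))))⁻¹ + (1 - 2 ^ (-(α : ℝ)))⁻¹
  have hG₁ : 0 ≤ (1 - (2 : ℝ) ^ (-(1 - (α : ℝ))))⁻¹ :=
    inv_nonneg.2 (sub_nonneg.2 (two_rpow_neg_lt_one (by linarith)).le)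
  have hG₂ : 0 ≤ (1 - (2 : ℝ) ^ (-(α : ℝ)))⁻¹ :=
    inv_nonneg.2 (sub_nonneg.2 (two_rpow_neg_lt_one hα0').le)
  have hG : 0 ≤ G := add_nonneg hG₁ hG₂
  refine ⟨max (2 ^ n * (1 - 2 ^ (-(α : ℝ)))⁻¹) (2 * 2 ^ n * n * G),
    (by positivity : (0 : ℝ) ≤ 2 * 2 ^ n * n * G).trans (le_max_right _ _),
    fun c F M hM hc => Lip.norm_le_of_bounds ?_ (fun x => ?_) fun x y => ?_⟩
  · exact mul_nonneg ((by positivity : (0 : ℝ) ≤ 2 * 2 ^ n * n * G).trans (le_max_right _ _)) hM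
  · refine (abs_sum_smul_schauderNormalised_apply_le hα0 hα1.le hM (fun τ _ => Nat.zero_le τ.1)
      hc x).trans ?_
    rw [pow_zero, mul_one]
    gcongr
    exact le_max_left _ _
  · rcases eq_or_ne x y with rfl | hxy
    · rw [sub_self, abs_zero, dist_self]
      have := (by positivity : (0 : ℝ) ≤ 2 * 2 ^ n * n * G).trans (le_max_right
        (2 ^ n * (1 - 2 ^ (-(α : ℝ)))⁻¹) _)
      positivity
    have hd : 0 < dist x y := dist_pos.2 hxy
    obtain ⟨N, hN⟩ := exists_subset_levels_Ico (F := F) fun τ _ => Nat.zero_le τ.1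
    rw [Nat.Ico_zero_eq_range, zero_add] at hN
    rw [sum_smul_schauderNormalised_apply, sum_smul_schauderNormalised_apply,
      ← Finset.sum_sub_distrib]
    calc |∑ τ ∈ F, (c τ * ((2 : ℝ) ^ (-(α : ℝ) * τ.1) * schauderC τ x) -
          c τ * ((2 : ℝ) ^ (-(α : ℝ) * τ.1) * schauderC τ y))|
        ≤ ∑ τ ∈ F, M * ((2 : ℝ) ^ (-(α : ℝ) * τ.1) * |schauderC τ x - schauderC τ y|) := by
          refine (Finset.abs_sum_le_sum_abs _ _).trans (Finset.sum_le_sum fun τ hτ => ?_)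
          rw [← mul_sub, ← mul_sub, abs_mul, abs_mul,
            abs_of_pos (by positivity : 0 < (2 : ℝ) ^ (-(α : ℝ) * τ.1))]
          gcongr
          exact hc τ hτ
      _ ≤ ∑ τ ∈ levels n (Finset.range N),
            M * ((2 : ℝ) ^ (-(α : ℝ) * τ.1) * |schauderC τ x - schauderC τ y|) :=
          Finset.sum_le_sum_of_subset_of_nonneg hN fun τ _ _ => by positivity
      _ = ∑ k ∈ Finset.range N, M * ((2 : ℝ) ^ (-(α : ℝ) * k) *
            ∑ τ : dyadicMulti n k, |schauderC ⟨k, τ⟩ x - schauderC ⟨k, τ⟩ y|) := by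
          rw [levels, Finset.sum_sigma]
          simp only [Finset.mul_sum]
      _ ≤ ∑ k ∈ Finset.range N, M * ((2 : ℝ) ^ (-(α : ℝ) * k) *
            (2 * 2 ^ n * (n * min 1 (2 ^ k * dist x y)))) := by
          gcongr with k
          refine (sum_abs_schauderC_sub_le k x y).trans ?_
          gcongr
          rw [mul_min_of_nonneg _ _ (Nat.cast_nonneg n), mul_one]
          exact min_le_min_right _ hn'
      _ = 2 * 2 ^ n * n * M * ∑ k ∈ Finset.range N,
            (2 : ℝ) ^ (-(α : ℝ) * k) * min 1 (2 ^ k * dist x y) := by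
          rw [Finset.mul_sum]
          exact Finset.sum_congr rfl fun k _ => by ring
      _ ≤ 2 * 2 ^ n * n * M * (G * dist x y ^ (α : ℝ)) := by
          gcongr
          exact sum_rpow_mul_min_le hα0' hα1' hd N
      _ = 2 * 2 ^ n * n * G * M * dist x y ^ (α : ℝ) := by ring
      _ ≤ _ := by
          gcongr
          exact le_max_right _ _

/-- The normalisation of the coefficient functional of level `k + 1` compensates increments of
order `2^{-α(k+1)}`. -/
theorem abs_pairing_coeffNormalised_le {k : ℕ} {τ : dyadicMulti n (k + 1)} {f : Lip (Cube n) α}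
    {B : ℝ}
    (h : ∀ ε, |f (node τ) - f (neighbour τ ε)| ≤ B * dist (node τ) (neighbour τ ε) ^ (α : ℝ))
    (hB : 0 ≤ B) : |pairing (coeffNormalised α ⟨k + 1, τ⟩) f| ≤ √n ^ (α : ℝ) * B := by
  rw [pairing_coeffNormalised_succ, abs_mul, abs_of_pos (by positivity)]
  have hsum : |∑ ε : Fin n → ℤˣ, (f (node τ) - f (neighbour τ ε))| ≤
      2 ^ n * (B * (√n * (2 ^ (k + 1))⁻¹) ^ (α : ℝ)) := by
    refine (Finset.abs_sum_le_sum_abs _ _).trans ?_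
    refine (Finset.sum_le_card_nsmul _ _ _ fun ε _ => (h ε).trans (mul_le_mul_of_nonneg_left
      (Real.rpow_le_rpow dist_nonneg (dist_node_neighbour_le τ ε) α.coe_nonneg) hB)).trans ?_
    simp
  refine (mul_le_mul_of_nonneg_left hsum (by positivity)).trans_eq ?_
  have hp : ((2 ^ (k + 1))⁻¹ : ℝ) ^ (α : ℝ) = (2 : ℝ) ^ (-((α : ℝ) * ((k + 1 : ℕ) : ℝ))) := by
    rw [← Real.rpow_natCast, ← Real.rpow_neg two_pos.le, ← Real.rpow_mul two_pos.le]
    congr 1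
    ring
  rw [Real.mul_rpow (Real.sqrt_nonneg _) (by positivity), hp, Real.rpow_sub two_pos,
    Real.rpow_neg two_pos.le, Real.rpow_natCast]
  have h₁ : (2 : ℝ) ^ ((α : ℝ) * ((k + 1 : ℕ) : ℝ)) ≠ 0 := by positivity
  field_simp

theorem abs_pairing_coeffNormalised_le_norm (hn : 1 ≤ n) (τ : Index n) (f : Lip (Cube n) α) :
    |pairing (coeffNormalised α τ) f| ≤ √n ^ (α : ℝ) * ‖f‖ := by
  obtain ⟨k, τ⟩ := τ
  cases k with
  | zero =>
    rw [pairing_coeffNormalised_zero]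
    refine (f.abs_apply_le_norm _).trans (le_mul_of_one_le_left (norm_nonneg f) ?_)
    exact Real.one_le_rpow (Real.one_le_sqrt.2 (by exact_mod_cast hn)) α.coe_nonneg
  | succ k =>
    exact abs_pairing_coeffNormalised_le (fun ε => f.abs_sub_le_norm_mul _ _) (norm_nonneg f)

/-- The coefficients of a locally flat function tend to zero with the level. -/
theorem exists_forall_abs_pairing_coeffNormalised_le {f : Lip (Cube n) α}
    (hf : f ∈ littleLip (Cube n) α) {η : ℝ} (hη : 0 < η) :
    ∃ K : ℕ, ∀ τ : Index n, K ≤ τ.1 →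
      |pairing (coeffNormalised α τ) f| ≤ √n ^ (α : ℝ) * η := by
  obtain ⟨δ, hδ, h⟩ := hf η hη
  have hlim : Tendsto (fun k : ℕ => √n * ((2 : ℝ) ^ k)⁻¹) atTop (𝓝 0) := by
    simpa using (tendsto_inv_atTop_zero.comp
      (tendsto_pow_atTop_atTop_of_one_lt (one_lt_two : (1 : ℝ) < 2))).const_mul √n
  obtain ⟨K, hK⟩ := eventually_atTop.1 (hlim.eventually_lt_const hδ)
  refine ⟨K + 1, ?_⟩
  rintro ⟨k, τ⟩ hk
  obtain ⟨k, rfl⟩ : ∃ m, k = m + 1 := ⟨k - 1, by dsimp at hk; omega⟩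
  refine abs_pairing_coeffNormalised_le (fun ε => ?_) hη.le
  rcases eq_or_ne (node τ) (neighbour τ ε) with he | he
  · rw [← he, sub_self, abs_zero]
    positivity
  · have hd := dist_pos.2 he
    have := h _ _ hd ((dist_node_neighbour_le τ ε).trans_lt (hK (k + 1) (by dsimp at hk; omega)))
    rwa [div_le_iff₀ (Real.rpow_pos_of_pos hd _)] at this

end Estimates

/-! ### Convergence of the series -/

section Convergence

variable {n : ℕ} {α : ℝ≥0}

theorem Cube.exists_mem_dyadicGrid_dist_le (k : ℕ) (x : Cube n) :
    ∃ y : Cube n, (∀ i, y.1 i ∈ dyadicGrid k) ∧ dist x y ≤ √n * (2 ^ k)⁻¹ := by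
  have h2 : (0 : ℝ) < 2 ^ k := by positivity
  -- Rounding the scaled coordinates down stays in the cube, also at the face `x i = 1`.
  set m : Fin n → ℕ := fun i => ⌊2 ^ k * x.1 i⌋₊
  have hm₁ : ∀ i, (m i : ℝ) ≤ 2 ^ k * x.1 i := fun i =>
    Nat.floor_le (mul_nonneg h2.le (x.2 i).1)
  have hm₂ : ∀ i, 2 ^ k * x.1 i < m i + 1 := fun i => Nat.lt_floor_add_one _
  have hy : ∀ i, (m i : ℝ) * (2 ^ k)⁻¹ ∈ dyadicGrid k := fun i => by
    refine mem_dyadicGrid_iff.2 ⟨m i, ?_, rfl⟩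
    have : (m i : ℝ) ≤ 2 ^ k := (hm₁ i).trans (mul_le_of_le_one_right h2.le (x.2 i).2)
    exact_mod_cast this
  refine ⟨⟨WithLp.toLp 2 fun i => (m i : ℝ) * (2 ^ k)⁻¹, fun i => ?_⟩, hy,
    Cube.dist_le_of_abs_sub_le (fun i => ?_) (by positivity)⟩
  · obtain ⟨j, -, hj⟩ := hy i
    exact dyadic_mem_Icc hj
  · change |x.1 i - m i * (2 ^ k)⁻¹| ≤ _
    have : x.1 i - m i * (2 ^ k)⁻¹ = (2 ^ k * x.1 i - m i) * (2 ^ k)⁻¹ := by field_simp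
    rw [this, abs_mul, abs_of_pos (inv_pos.2 h2)]
    refine mul_le_of_le_one_left (inv_pos.2 h2).le (abs_le.2 ⟨?_, ?_⟩)
    · linarith [hm₁ i]
    · linarith [hm₂ i]

theorem partialSum_sub_partialSum_of_subset (hα : α ≤ 1) (f : Lip (Cube n) α)
    {F G : Finset (Index n)} (h : G ⊆ F) :
    partialSum hα f F - partialSum hα f G =
      ∑ τ ∈ F.filter (· ∉ G), pairing (coeffNormalised α τ) f • schauderNormalised hα τ := by
  classical
  rw [sub_eq_iff_eq_add, partialSum, partialSum, Finset.filter_notMem_eq_sdiff,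
    Finset.sum_sdiff h]

theorem le_of_mem_filter_notMem_levels {F : Finset (Index n)} {K : ℕ} {τ : Index n}
    (hτ : τ ∈ F.filter (· ∉ levels n (Finset.range K))) : K ≤ τ.1 := by
  have := (Finset.mem_filter.1 hτ).2
  rw [mem_levels, Finset.mem_range] at this
  omega

theorem exists_norm_partialSum_le (hn : 1 ≤ n) (hα0 : 0 < α) (hα1 : α < 1)
    (f : Lip (Cube n) α) : ∃ B : ℝ, 0 ≤ B ∧ ∀ F, ‖partialSum hα1.le f F‖ ≤ B := by
  obtain ⟨C, hC, h⟩ := exists_norm_sum_smul_schauderNormalised_le hn hα0 hα1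
  exact ⟨C * (√n ^ (α : ℝ) * ‖f‖), by positivity, fun F => h _ F _ (by positivity)
    fun τ _ => abs_pairing_coeffNormalised_le_norm hn τ f⟩

/-- The full sum over the levels up to `K` agrees with `f` on a fine grid and is Hölder continuous
uniformly in `K`, hence is uniformly close to `f`; the remaining terms are uniformly small. -/
theorem tendstoUniformly_partialSum (hn : 1 ≤ n) (hα0 : 0 < α) (hα1 : α < 1)
    (f : Lip (Cube n) α) : TendstoUniformly (fun F x => partialSum hα1.le f F x) f atTop := by
  have hα0' : (0 : ℝ) < α := by exact_mod_cast hα0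
  obtain ⟨B, hB, hP⟩ := exists_norm_partialSum_le hn hα0 hα1 f
  set M := √n ^ (α : ℝ) * ‖f‖
  set A := 2 ^ n * (1 - 2 ^ (-(α : ℝ)))⁻¹ * M
  set s := (2 : ℝ) ^ (-(α : ℝ))
  have hlim : Tendsto (fun K : ℕ => (B + ‖f‖) * (√n * ((2 : ℝ) ^ K)⁻¹) ^ (α : ℝ) + A * s ^ (K + 1))
      atTop (𝓝 0) := by
    have h₁ : Tendsto (fun K : ℕ => √n * ((2 : ℝ) ^ K)⁻¹) atTop (𝓝 0) := by
      simpa using (tendsto_inv_atTop_zero.comp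
        (tendsto_pow_atTop_atTop_of_one_lt (one_lt_two : (1 : ℝ) < 2))).const_mul √n
    have h₂ := (h₁.rpow_const (p := (α : ℝ)) (Or.inr hα0'.le)).const_mul (B + ‖f‖)
    have h₃ : Tendsto (fun K : ℕ => A * s ^ (K + 1)) atTop (𝓝 (A * 0)) :=
      (((tendsto_pow_atTop_nhds_zero_of_lt_one (by positivity)
        (two_rpow_neg_lt_one hα0')).comp (tendsto_add_atTop_nat 1))).const_mul A
    simpa [Real.zero_rpow hα0'.ne'] using h₂.add h₃
  rw [Metric.tendstoUniformly_iff]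
  intro ε hε
  obtain ⟨K, hK⟩ := (hlim.eventually_lt_const hε).exists
  filter_upwards [eventually_ge_atTop (levels n (Finset.range (K + 1)))] with F hF x
  obtain ⟨y, hy, hxy⟩ := Cube.exists_mem_dyadicGrid_dist_le K x
  set P := partialSum hα1.le f
  set L := levels n (Finset.range (K + 1))
  have hrpow : dist x y ^ (α : ℝ) ≤ (√n * ((2 : ℝ) ^ K)⁻¹) ^ (α : ℝ) :=
    Real.rpow_le_rpow dist_nonneg hxy hα0'.le
  have hfxy : |f x - f y| ≤ ‖f‖ * (√n * ((2 : ℝ) ^ K)⁻¹) ^ (α : ℝ) :=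
    (f.abs_sub_le_norm_mul x y).trans (by gcongr)
  have hPxy : |P L x - P L y| ≤ B * (√n * ((2 : ℝ) ^ K)⁻¹) ^ (α : ℝ) :=
    ((P L).abs_sub_le_norm_mul x y).trans (by gcongr; exact hP L)
  have hPy : P L y = f y := partialSum_levels_eq_on_dyadicGrid hn hα1.le f K y hy
  have htail : |P F x - P L x| ≤ A * s ^ (K + 1) := by
    have := abs_sum_smul_schauderNormalised_apply_le hα0 hα1.le
      (c := fun τ => pairing (coeffNormalised α τ) f) (F := F.filter (· ∉ L)) (K := K + 1)
      (M := M) (by positivity) (fun τ hτ => le_of_mem_filter_notMem_levels hτ)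
      (fun τ _ => abs_pairing_coeffNormalised_le_norm hn τ f) x
    rw [← partialSum_sub_partialSum_of_subset hα1.le f hF] at this
    exact this
  rw [Real.dist_eq]
  rw [abs_le] at hfxy hPxy htail
  refine lt_of_le_of_lt (abs_le.2 ⟨?_, ?_⟩) hK <;> linarith

/-- For locally flat `f` the coefficients of high level are small, so that the partial sums
containing all the lower levels are close to each other in norm, and hence to their pointwise
limit `f`. -/
theorem tendsto_partialSum_of_mem_littleLip (hn : 1 ≤ n) (hα0 : 0 < α) (hα1 : α < 1)
    {f : Lip (Cube n) α} (hf : f ∈ littleLip (Cube n) α) :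
    Tendsto (partialSum hα1.le f) atTop (𝓝 f) := by
  obtain ⟨C, hC, hnorm⟩ := exists_norm_sum_smul_schauderNormalised_le hn hα0 hα1
  rw [Metric.tendsto_nhds]
  intro ε hε
  -- `D * η < ε / 2` for `η = ε / (2 * (D + 1))`, also when `D = 0`.
  set D := C * √n ^ (α : ℝ)
  have hD : 0 ≤ D := by positivity
  obtain ⟨K, hK⟩ := exists_forall_abs_pairing_coeffNormalised_le hf
    (η := ε / (2 * (D + 1))) (by positivity)
  set L := levels n (Finset.range K)
  have hclose : ∀ F, L ⊆ F →
      ‖partialSum hα1.le f F - partialSum hα1.le f L‖ ≤ D * (ε / (2 * (D + 1))) := by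
    intro F hF
    rw [partialSum_sub_partialSum_of_subset hα1.le f hF, mul_assoc]
    exact hnorm _ _ _ (by positivity) fun τ hτ => hK τ (le_of_mem_filter_notMem_levels hτ)
  have hlim : ‖f - partialSum hα1.le f L‖ ≤ D * (ε / (2 * (D + 1))) :=
    Lip.norm_sub_le_of_tendsto (l := atTop)
      (fun x => (tendstoUniformly_partialSum hn hα0 hα1 f).tendsto_at x)
      ((eventually_ge_atTop L).mono hclose)
  have hsmall : D * (ε / (2 * (D + 1))) < ε / 2 := by
    rw [← mul_div_assoc, div_lt_iff₀ (by positivity)]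
    nlinarith
  filter_upwards [eventually_ge_atTop L] with F hF
  rw [dist_eq_norm]
  calc ‖partialSum hα1.le f F - f‖
      ≤ ‖partialSum hα1.le f F - partialSum hα1.le f L‖ + ‖partialSum hα1.le f L - f‖ :=
        norm_sub_le_norm_sub_add_norm_sub _ _ _
    _ < ε := by
      rw [norm_sub_rev _ f]
      linarith [hclose F hF]

end Convergence

end FaberSchauder

end

theorem mainTheorem7 (n : ℕ) (hn : 1 ≤ n) (α : ℝ≥0) (hα0 : 0 < α) (hα1 : α < 1)
    (f : Lip (Cube n) α) :
    -- the series converges to `f` weakly-*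
    Tendsto (partialSum hα1.le f) atTop (@nhds _ (weakStar (Cube n) α) f) ∧
    -- it converges to `f` uniformly
    TendstoUniformly (fun F x => partialSum hα1.le f F x) f atTop ∧
    -- both are equivalent: the partial sums are bounded, and the two topologies agree on
    -- bounded sets
    Bornology.IsBounded (Set.range (partialSum hα1.le f)) ∧
    (∀ s : Set (Lip (Cube n) α), Bornology.IsBounded s →
      TopologicalSpace.induced (Subtype.val : s → Lip (Cube n) α) (weakStar (Cube n) α) =
        TopologicalSpace.induced (Subtype.val : s → Lip (Cube n) α)
          (uniformTopology (Cube n) α)) ∧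
    -- for locally flat `f` it converges to `f` in the Lipschitz norm
    (f ∈ littleLip (Cube n) α → Tendsto (partialSum hα1.le f) atTop (𝓝 f)) := by
  obtain ⟨B, -, hB⟩ := exists_norm_partialSum_le hn hα0 hα1 f
  have hunif := tendstoUniformly_partialSum hn hα0 hα1 f
  refine ⟨?_, hunif, isBounded_iff_forall_norm_le.2 ⟨B, forall_mem_range.2 hB⟩,
    fun s hs => induced_weakStar_eq_induced_uniformTopology hα0 hs,
    fun hf => tendsto_partialSum_of_mem_littleLip hn hα0 hα1 hf⟩
  rw [nhds_induced, tendsto_comap_iff]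
  exact tendsto_toDualPredual hB (ContinuousMap.tendsto_iff_tendstoUniformly.2 hunif)
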